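/- \textbf{First law for Newtonian binaries.} Let $G>0$ and $\Omega\in\mathbb R$. Let $u(\rho,s)$ be a specific internal energy, with pressure $P=\rho^2(\partial u/\partial\rho)_s$ and temperature $T=(\partial u/\partial s)_\rho$; assume that $u$ is $C^2$ for $\rho>0$ and that $u$, $P/\rho$ and $\rho T$ stay bounded as $\rho\to0^+$, locally uniformly in $s$. Let $\phi=(-y,x,0)$ be the generator of rotations of $\mathbb R^3$ about the third axis. For a configuration $(\rho,s,v,\Phi)$ of a self-gravitating fluid put $$E=\int_{\mathbb R^3}\Big(\tfrac12\rho |v|^2+\rho\,\Phi+\tfrac1{8\pi G}|\nabla\Phi|^2+\rho\,u(\rho,s)\Big)dV,\qquad J=\int_{\mathbb R^3}\rho\, v_i\phi^i\,dV .$$ \emph{The binary.} Let $(\rho,s,v,\Phi)(t,x)$ be a time-dependent configuration such that: $\rho\ge0$ is continuous (so it vanishes at the surface of the fluid), the fluid region $\{x:\rho(t,x)>0\}$ is bounded for every $t$, $\rho$ is $C^1$ where it is positive, $s$ and $v$ are restrictions of $C^1$ functions on $\mathbb R\times\mathbb R^3$, and $\Phi(t,\cdot)$ is $C^2$ and tends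 to $0$ at infinity. Assume that in the fluid $$\partial_t\rho+\nabla_i(\rho v^i)=0,\qquad \partial_tv_i+v^j\nabla_jv_i=-\tfrac1\rho\nabla_iP-\nabla_i\Phi,$$ that $\nabla^2\Phi=4\pi G\rho$ on $\mathbb R^3$, and that the fluid variables are helically symmetric: $(\partial_t+\Omega\,\mathcal L_\phi)\rho=0$, $(\partial_t+\Omega\,\mathcal L_\phi)s=0$, $(\partial_t+\Omega\,\mathcal L_\phi)v=0$ in the fluid. \emph{The perturbation.} Fix a time $t_0$. Let $(\rho_\lambda,s_\lambda,v_\lambda,\Phi_\lambda)_{\lambda\in\mathbb R}$ be a family of configurations on $\mathbb R^3$ which at $\lambda=0$ is the given one at time $t_0$, with $\rho_\lambda\ge0$, and let $\Psi_\lambda$ be diffeomorphisms of $\mathbb R^3$, jointly $C^3$ in $(\lambda,x)$, with $\Psi_0=\mathrm{id}$, such that $\Psi_\lambda$ maps the fluid region of the configuration $0$ onto that of the configuration $\lambda$. Assume that $\rho_\lambda(\Psi_\lambda(x))$ is differentiable in $\lambda$ with derivative continuous in $(\lambda,x)$; that $s_\lambda(x)$ is $C^1$, and $v_\lambda(x)$,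 $\Phi_\lambda(x)$ are $C^2$, in $(\lambda,x)$; and that $|\nabla\Phi_\lambda|\le C(1+|x|)^{-2}$, $|\partial_\lambda\Phi_\lambda|\le C(1+|x|)^{-1}$, $|\partial_\lambda\nabla\Phi_\lambda|\le C(1+|x|)^{-2}$ for all $|\lambda|\le1$. No field equation is imposed for $\lambda\neq0$. For a tensor field $\mathcal Q_\lambda$ let $\delta$ denote the $\lambda$-derivative at $\lambda=0$ and let $\Delta \mathcal Q=\frac{d}{d\lambda}\big|_{\lambda=0}\Psi_\lambda^*\mathcal Q_\lambda$ be its Lagrangian change; here $v_i$ is pulled back as a covector field, $\omega_{ij}=\nabla_jv_i-\nabla_iv_j$ as a two-form and $\rho\,dV$ as a volume density. Then, for $\lambda$ near $0$, the integrals defining $E$ and $J$ converge absolutely; $E$ and $J$ are differentiable at $\lambda=0$; and $$\delta E=\Omega\,\delta J+\int\rho\,T\,\Delta s\,dV+\int\Big(\tfrac12v^2+\Phi+u+\frac P\rho-\Omega\, v_i\phi^i\Big)\Delta(\rho\,dV)+\int\rho\,(v^i-\Omega\phi^i)\,\Delta v_i\,dV ,$$ where the three integrals, over the fluid, converge absolutely.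 If moreover every connected component of the fluid region at $\lambda=0$ (each star) is simply connected and the perturbation is isentropic, mass-conserving and vorticity-conserving, that is $\Delta s=0$, $\Delta(\rho\,dV)=0$ and $\Delta\omega_{ij}=0$ in the fluid, then $\delta E=\Omega\,\delta J$. -/

import Mathlib

open Set Filter Topology MeasureTheory

noncomputable section

namespace NewtonianBinary

/-- Euclidean three-space. -/
abbrev E3 : Type := EuclideanSpace ℝ (Fin 3)

/-- The instantaneous configuration of a self-gravitating perfect fluid: mass density, specific
entropy, inertial-frame velocity and gravitational potential. The values of `s` and `v` where the
density vanishes carry no meaning. -/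
structure FluidState where
  ρ : E3 → ℝ
  s : E3 → ℝ
  v : E3 → E3
  Φ : E3 → ℝ

/-- The region occupied by the fluid. -/
def FluidState.region (S : FluidState) : Set E3 := {x | 0 < S.ρ x}

/-! ### Equation of state

The equation of state is given by the specific internal energy `u ρ s`; the pressure and the
temperature are read off from `du = T ds + (P / ρ ^ 2) dρ`. -/

/-- Pressure `P = ρ ^ 2 (∂u/∂ρ)_s`. -/
def pressure (u : ℝ → ℝ → ℝ) (r s : ℝ) : ℝ := r ^ 2 * deriv (fun q => u q s) r

/-- Temperature `T = (∂u/∂s)_ρ`. -/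
def temperature (u : ℝ → ℝ → ℝ) (r s : ℝ) : ℝ := deriv (fun q => u r q) s

/-- The equation of state is twice continuously differentiable at positive densities, and
`u`, `P / ρ`, `ρ T` stay bounded as the density tends to zero with bounded entropy. -/
structure IsRegularEOS (u : ℝ → ℝ → ℝ) : Prop where
  contDiffOn : ContDiffOn ℝ 2 (fun p : ℝ × ℝ => u p.1 p.2) (Ioi 0 ×ˢ univ)
  bounded : ∀ R : ℝ, ∃ C : ℝ, ∀ r s : ℝ, 0 < r → r ≤ R → |s| ≤ R →
    |u r s| ≤ C ∧ |pressure u r s / r| ≤ C ∧ |r * temperature u r s| ≤ C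

/-- The pressure field of a configuration. -/
def FluidState.P (u : ℝ → ℝ → ℝ) (S : FluidState) (x : E3) : ℝ := pressure u (S.ρ x) (S.s x)

/-! ### Vector calculus -/

/-- Divergence of a vector field on `ℝ³`. -/
def divergence (F : E3 → E3) (x : E3) : ℝ :=
  ∑ i : Fin 3, (fderiv ℝ F x (EuclideanSpace.single i 1)) i

/-- The generator `(-y, x, 0)` of rotations about the third axis. -/
def rotGen (x : E3) : E3 := !₂[-x 1, x 0, 0]

/-- The vorticity two-form `ω_ij = ∂_j v_i - ∂_i v_j`, evaluated on a pair of vectors. -/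
def vorticity (v : E3 → E3) (x a b : E3) : ℝ :=
  inner ℝ (fderiv ℝ v x b) a - inner ℝ (fderiv ℝ v x a) b

/-! ### Energy and angular momentum -/

def kineticDensity (S : FluidState) (x : E3) : ℝ := 1 / 2 * S.ρ x * ‖S.v x‖ ^ 2

def gravDensity (G : ℝ) (S : FluidState) (x : E3) : ℝ :=
  S.ρ x * S.Φ x + 1 / (8 * Real.pi * G) * ‖gradient S.Φ x‖ ^ 2

def internalDensity (u : ℝ → ℝ → ℝ) (S : FluidState) (x : E3) : ℝ :=
  S.ρ x * u (S.ρ x) (S.s x)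

def angularDensity (S : FluidState) (x : E3) : ℝ := S.ρ x * inner ℝ (S.v x) (rotGen x)

/-- The energy `E = T + W + U`. -/
def energy (G : ℝ) (u : ℝ → ℝ → ℝ) (S : FluidState) : ℝ :=
  (∫ x, kineticDensity S x) + (∫ x, gravDensity G S x) + ∫ x, internalDensity u S x

/-- The angular momentum `J` about the third axis. -/
def angularMomentum (S : FluidState) : ℝ := ∫ x, angularDensity S x

/-! ### Helically symmetric binaries -/

/-- `Q t` is the configuration at time `t` of an isolated self-gravitating perfect fluid which
satisfies the mass conservation, Euler and Poisson equations and is helically symmetric with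
angular velocity `Ω`. The density is continuous on all of space, so it vanishes at the surface of
the fluid, where it need not be differentiable; `v` and `s` are differentiable up to the surface,
as restrictions of functions defined on all of space. -/
structure IsHelicalBinary (G Ω : ℝ) (u : ℝ → ℝ → ℝ) (Q : ℝ → FluidState) : Prop where
  density_nonneg : ∀ t x, 0 ≤ (Q t).ρ x
  density_continuous : Continuous fun p : ℝ × E3 => (Q p.1).ρ p.2
  density_contDiffOn :
    ContDiffOn ℝ 1 (fun p : ℝ × E3 => (Q p.1).ρ p.2) {p | p.2 ∈ (Q p.1).region}
  region_bounded : ∀ t, Bornology.IsBounded (Q t).region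
  entropy_contDiff : ContDiff ℝ 1 fun p : ℝ × E3 => (Q p.1).s p.2
  velocity_contDiff : ContDiff ℝ 1 fun p : ℝ × E3 => (Q p.1).v p.2
  potential_contDiff : ∀ t, ContDiff ℝ 2 (Q t).Φ
  potential_tendsto : ∀ t, Tendsto (Q t).Φ (cocompact E3) (𝓝 0)
  /-- Mass conservation. -/
  continuity : ∀ t, ∀ x ∈ (Q t).region,
    deriv (fun τ => (Q τ).ρ x) t + divergence (fun y => (Q t).ρ y • (Q t).v y) x = 0
  /-- Euler equation. -/
  euler : ∀ t, ∀ x ∈ (Q t).region,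
    deriv (fun τ => (Q τ).v x) t + fderiv ℝ (Q t).v x ((Q t).v x) =
      -((1 / (Q t).ρ x) • gradient ((Q t).P u) x) - gradient (Q t).Φ x
  /-- Poisson equation. -/
  poisson : ∀ t x, Laplacian.laplacian (Q t).Φ x = 4 * Real.pi * G * (Q t).ρ x
  /-- Helical symmetry of the density: `(∂_t + Ω £_φ) ρ = 0`. -/
  helical_density : ∀ t, ∀ x ∈ (Q t).region,
    deriv (fun τ => (Q τ).ρ x) t + Ω * fderiv ℝ (Q t).ρ x (rotGen x) = 0
  /-- Helical symmetry of the entropy: `(∂_t + Ω £_φ) s = 0`. -/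
  helical_entropy : ∀ t, ∀ x ∈ (Q t).region,
    deriv (fun τ => (Q τ).s x) t + Ω * fderiv ℝ (Q t).s x (rotGen x) = 0
  /-- Helical symmetry of the velocity: `(∂_t + Ω £_φ) v = 0`. -/
  helical_velocity : ∀ t, ∀ x ∈ (Q t).region,
    deriv (fun τ => (Q τ).v x) t + Ω • VectorField.lieBracket ℝ rotGen (Q t).v x = 0

/-! ### Perturbations -/

/-- `S l` is a one-parameter family of neighbouring configurations, and `Ψ l` a family of
diffeomorphisms of space starting at the identity which carries the fluid of `S 0` onto the fluid
of `S l`. No field equation is imposed for `l ≠ 0`. The potentials are asymptotically flat,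
uniformly near `l = 0`, in the sense that `∇Φ = O(r⁻²)`, `∂_l Φ = O(r⁻¹)`, `∂_l ∇Φ = O(r⁻²)`. -/
structure IsPerturbation (S : ℝ → FluidState) (Ψ : ℝ → E3 → E3) : Prop where
  map_contDiff : ContDiff ℝ 3 fun p : ℝ × E3 => Ψ p.1 p.2
  map_zero : ∀ x, Ψ 0 x = x
  map_bijective : ∀ l, Function.Bijective (Ψ l)
  map_det_ne_zero : ∀ l x, (fderiv ℝ (Ψ l) x).det ≠ 0
  map_region : ∀ l x, Ψ l x ∈ (S l).region ↔ x ∈ (S 0).region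
  density_nonneg : ∀ l x, 0 ≤ (S l).ρ x
  /-- The density of each fluid element is continuously differentiable in the parameter. -/
  density_differentiable : ∀ x, Differentiable ℝ fun l => (S l).ρ (Ψ l x)
  density_deriv_continuous :
    Continuous fun p : ℝ × E3 => deriv (fun l => (S l).ρ (Ψ l p.2)) p.1
  entropy_contDiff : ContDiff ℝ 1 fun p : ℝ × E3 => (S p.1).s p.2
  velocity_contDiff : ContDiff ℝ 2 fun p : ℝ × E3 => (S p.1).v p.2
  potential_contDiff : ContDiff ℝ 2 fun p : ℝ × E3 => (S p.1).Φ p.2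
  potential_decay : ∃ C : ℝ, ∀ l ∈ Icc (-1 : ℝ) 1, ∀ x : E3,
    ‖gradient (S l).Φ x‖ ≤ C / (1 + ‖x‖) ^ 2 ∧
    |deriv (fun m => (S m).Φ x) l| ≤ C / (1 + ‖x‖) ∧
    ‖deriv (fun m => gradient (S m).Φ x) l‖ ≤ C / (1 + ‖x‖) ^ 2

/-! The Lagrangian change of a tensor field is the derivative at `l = 0` of its pullback under
`Ψ l`. -/

/-- `Δs`. -/
def lagEntropy (S : ℝ → FluidState) (Ψ : ℝ → E3 → E3) (x : E3) : ℝ :=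
  deriv (fun l => (S l).s (Ψ l x)) 0

/-- `Δ(ρ dV)`, as a density with respect to `dV`. -/
def lagMass (S : ℝ → FluidState) (Ψ : ℝ → E3 → E3) (x : E3) : ℝ :=
  deriv (fun l => (S l).ρ (Ψ l x) * (fderiv ℝ (Ψ l) x).det) 0

/-- `w ^ i Δv_i`, where `v_i` is the velocity covector field. -/
def lagVelocity (S : ℝ → FluidState) (Ψ : ℝ → E3 → E3) (x w : E3) : ℝ :=
  deriv (fun l => (inner ℝ ((S l).v (Ψ l x)) (fderiv ℝ (Ψ l) x w) : ℝ)) 0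

/-- `Δω_ij a ^ i b ^ j`. -/
def lagVorticity (S : ℝ → FluidState) (Ψ : ℝ → E3 → E3) (x a b : E3) : ℝ :=
  deriv (fun l => vorticity (S l).v (Ψ l x) (fderiv ℝ (Ψ l) x a) (fderiv ℝ (Ψ l) x b)) 0

/-! The integrands of the first law, all evaluated at `l = 0`. -/

/-- `ρ T Δs`. -/
def heatTerm (u : ℝ → ℝ → ℝ) (S : ℝ → FluidState) (Ψ : ℝ → E3 → E3) (x : E3) : ℝ :=
  (S 0).ρ x * temperature u ((S 0).ρ x) ((S 0).s x) * lagEntropy S Ψ x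

/-- `(v² / 2 + Φ + u + P / ρ - Ω v_i φ^i) Δ(ρ dV)`. -/
def massTerm (Ω : ℝ) (u : ℝ → ℝ → ℝ) (S : ℝ → FluidState) (Ψ : ℝ → E3 → E3) (x : E3) : ℝ :=
  (1 / 2 * ‖(S 0).v x‖ ^ 2 + (S 0).Φ x + u ((S 0).ρ x) ((S 0).s x)
    + (S 0).P u x / (S 0).ρ x - Ω * inner ℝ ((S 0).v x) (rotGen x)) * lagMass S Ψ x

/-- `ρ (v^i - Ω φ^i) Δv_i`. -/
def circulationTerm (Ω : ℝ) (S : ℝ → FluidState) (Ψ : ℝ → E3 → E3) (x : E3) : ℝ :=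
  (S 0).ρ x * lagVelocity S Ψ x ((S 0).v x - Ω • rotGen x)

end NewtonianBinary

end

/-! Pulling every integral back by `Ψ l` turns it into an integral over the fixed, bounded fluid
region, where it can be differentiated under the integral sign. Write ξ for the derivative of `Ψ l`
at `l = 0`, v̇ for that of v along the displaced fluid element, w = v - Ωφ for the velocity in the
corotating frame and F = ∇_w v + Ω φ(v) + ∇Φ.

The variation of ∫ρΦ contains ∫ρ δΦ. By the Poisson equation at `l = 0` and Green's identity the
field energy contributes exactly its negative (`IsPerturbation.hasDerivAt_integral_field`). The
internal energy yields (u + P/ρ) Δ(ρ dV) + ρTΔs - P div ξ. Collecting terms, and using that φ is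
skew, the difference of the two sides of the first law is -∫(P div ξ - ρ⟨F, ξ⟩) - ∫ρ w·∇⟨v, ξ⟩. Both
integrals vanish: - Euler's equation and helical symmetry give ∇P = -ρF, so the first integrand is
div(Pξ). This is legitimate because P, extended by zero, is C¹ on all of space
(`IsHelicalBinary.hasFDerivAt_pressure`), although ρ need not be and nothing is known about the
boundary of the fluid. - Mass conservation and helical symmetry give div(ρw) = 0 in the fluid. As ρ
vanishes continuously at the surface, ∫ρ w·∇f = 0 for every C¹ function f with bounded gradient
(`integral_mul_fderiv_eq_zero`); here f = ⟨v, ξ⟩.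

For the last assertion only the circulation term ∫ρ α(w) survives, where α is the one-form Δv_i. Its
exterior derivative is Δω up to sign, so α is closed, and on simply connected stars α = df
(`exists_primitive_of_components`). The same flux lemma, applied to f, finishes the proof. The
gradient of f is bounded but f may be unbounded when the region is irregular, which is why that
lemma asks only for a bound on the gradient. -/

namespace NewtonianBinary

/-! ### Primitives of closed one-forms on simply connected open sets -/

section Primitive

variable {E : Type*} [NormedAddCommGroup E] [NormedSpace ℝ E]

/-- Makes the transition functions of the bundle of local primitives locally constant: the
intersection of two balls is convex, so two primitives differ there by a constant. -/
theorem sub_eq_sub_of_hasFDerivAt_eq {s : Set E} (hs : Convex ℝ s) (hso : IsOpen s)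
    {f g : E → ℝ} {α : E → E →L[ℝ] ℝ} (hf : ∀ a ∈ s, HasFDerivAt f (α a) a)
    (hg : ∀ a ∈ s, HasFDerivAt g (α a) a) {x y : E} (hx : x ∈ s) (hy : y ∈ s) :
    f x - g x = f y - g y := by
  have h : ∀ a ∈ s, HasFDerivWithinAt (f - g) (0 : E →L[ℝ] ℝ) s a := fun a ha => by
    simpa using ((hf a ha).sub (hg a ha)).hasFDerivWithinAt
  exact hs.is_const_of_fderivWithin_eq_zero (fun a ha => (h a ha).differentiableWithinAt)
    (fun a ha => (h a ha).fderivWithin (hso.uniqueDiffOn a ha)) hx hy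

/-- The covering space of germs of local primitives of a one-form. -/
def primitiveBundle {F : Type*} [TopologicalSpace F] [DiscreteTopology F] (e : F ≃ ℝ)
    {U : Set E} {α : E → E →L[ℝ] ℝ} (r : U → ℝ) (hr : ∀ i, 0 < r i) (f : U → E → ℝ)
    (hf : ∀ i : U, ∀ a ∈ Metric.ball (i : E) (r i), HasFDerivAt (f i) (α a) a) :
    FiberBundleCore U U F where
  baseSet i := {x | (x : E) ∈ Metric.ball (i : E) (r i)}
  isOpen_baseSet i := Metric.isOpen_ball.preimage continuous_subtype_val
  indexAt x := x
  mem_baseSet_at x := Metric.mem_ball_self (hr x)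
  -- In chart `i`, the fibre coordinate `c` stands for the germ of `f i + e c`. The fibre `F` is a
  -- copy of ℝ with the discrete topology, which makes the bundle a covering.
  coordChange i j x c := e.symm (e c + (f i x - f j x))
  coordChange_self i x _ c := by simp
  continuousOn_coordChange i j p hp := by
    have key : ∀ q ∈ ({x : U | (x : E) ∈ Metric.ball (i : E) (r i)} ∩
        {x : U | (x : E) ∈ Metric.ball (j : E) (r j)}) ×ˢ (univ : Set F),
        e.symm (e q.2 + (f i q.1 - f j q.1)) = e.symm (e q.2 + (f i p.1 - f j p.1)) := by
      intro q hq
      rw [sub_eq_sub_of_hasFDerivAt_eq ((convex_ball _ _).inter (convex_ball _ _))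
        (Metric.isOpen_ball.inter Metric.isOpen_ball) (fun a ha => hf i a ha.1)
        (fun a ha => hf j a ha.2) hq.1 hp.1]
    exact ((continuous_of_discreteTopology
      (f := fun c => e.symm (e c + (f i p.1 - f j p.1)))).comp
        continuous_snd).continuousWithinAt.congr key (key p hp)
  coordChange_comp i j k x _ c := by simp; ring

/-- Monodromy argument: over a simply connected base the identity lifts to a continuous section of
the covering by germs of primitives, and evaluating each chosen germ at its base point gives a
global primitive. Near any point the section is constant in a trivialization, so the result is one
local primitive plus a constant. -/
theorem exists_primitive_aux {F : Type*} [TopologicalSpace F] [DiscreteTopology F] (e : F ≃ ℝ)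
    {U : Set E} (hU : IsOpen U) (hsc : IsSimplyConnected U) {α : E → E →L[ℝ] ℝ}
    (hα : DifferentiableOn ℝ α U)
    (hsym : ∀ a ∈ U, ∀ x y, fderiv ℝ α a x y = fderiv ℝ α a y x) :
    ∃ f : E → ℝ, ∀ a ∈ U, HasFDerivAt f (α a) a := by
  classical
  have hloc : ∀ i : U, ∃ r : ℝ, 0 < r ∧ ∃ f : E → ℝ,
      ∀ a ∈ Metric.ball (i : E) r, HasFDerivAt f (α a) a := by
    intro i
    obtain ⟨r, hr, hrU⟩ := Metric.isOpen_iff.1 hU i i.2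
    exact ⟨r, hr, (convex_ball _ _).exists_forall_hasFDerivAt_of_fderiv_symmetric
      Metric.isOpen_ball (hα.mono hrU) fun a ha => hsym a (hrU ha)⟩
  choose r hr f hf using hloc
  let Z := primitiveBundle e r hr f hf
  have hcov : IsCoveringMap (Bundle.TotalSpace.proj : Z.TotalSpace → U) :=
    FiberBundle.isCoveringMap (F := F) (E := Z.Fiber)
  have := hsc.simplyConnectedSpace
  have := hU.locallyPathConnectedSpace
  obtain ⟨x₀, hx₀⟩ := hsc.nonempty
  obtain ⟨σ, ⟨-, hσ⟩, -⟩ := hcov.existsUnique_continuousMap_lifts (ContinuousMap.id U) ⟨x₀, hx₀⟩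
    (⟨⟨x₀, hx₀⟩, e.symm 0⟩ : Z.TotalSpace) rfl
  have hσ1 : ∀ x : U, (σ x).1 = x := fun x => congrFun hσ x
  let val : Z.TotalSpace → ℝ := fun p => e p.2 + f p.1 p.1
  refine ⟨fun x => if hx : x ∈ U then val (σ ⟨x, hx⟩) else 0, fun a ha => ?_⟩
  have hcont : ContinuousAt (fun x : U => (Z.localTriv ⟨a, ha⟩ (σ x)).2) ⟨a, ha⟩ := by
    have h1 : ContinuousAt (Z.localTriv ⟨a, ha⟩) (σ ⟨a, ha⟩) := by
      apply (Z.localTriv ⟨a, ha⟩).continuousOn.continuousAt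
      apply (Z.localTriv ⟨a, ha⟩).open_source.mem_nhds
      rw [(Z.localTriv ⟨a, ha⟩).mem_source]
      change (σ ⟨a, ha⟩).1 ∈ Z.baseSet ⟨a, ha⟩
      rw [hσ1]
      exact Z.mem_baseSet_at ⟨a, ha⟩
    exact (ContinuousAt.comp (f := σ) h1 σ.continuous.continuousAt).snd
  have hev : ∀ᶠ x : U in 𝓝 ⟨a, ha⟩, (Z.localTriv ⟨a, ha⟩ (σ x)).2 =
      (Z.localTriv ⟨a, ha⟩ (σ ⟨a, ha⟩)).2 :=
    hcont.eventually (show ({_} : Set F) ∈ _ from (isOpen_discrete _).mem_nhds rfl)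
  have htriv : ∀ p : Z.TotalSpace, val p = e (Z.localTriv ⟨a, ha⟩ p).2 + f ⟨a, ha⟩ p.1 := by
    intro p
    have : (Z.localTriv ⟨a, ha⟩ p).2 = e.symm (e p.2 + (f p.1 p.1 - f ⟨a, ha⟩ p.1)) := rfl
    rw [this]
    simp only [val, Equiv.apply_symm_apply]
    ring
  have hev' : ∀ᶠ x in 𝓝 a, (if hx : x ∈ U then val (σ ⟨x, hx⟩) else 0) =
      e (Z.localTriv ⟨a, ha⟩ (σ ⟨a, ha⟩)).2 + f ⟨a, ha⟩ x := by
    rw [← map_nhds_subtype_coe_eq_nhds ha (hU.mem_nhds ha), eventually_map]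
    filter_upwards [hev] with x hx
    rw [dif_pos x.2, htriv, hx, hσ1]
  exact ((hf ⟨a, ha⟩ a (Metric.mem_ball_self (hr _))).const_add _).congr_of_eventuallyEq hev'

/-- A closed one-form on a simply connected open set is exact. -/
theorem exists_primitive_of_isSimplyConnected {U : Set E} (hU : IsOpen U)
    (hsc : IsSimplyConnected U) {α : E → E →L[ℝ] ℝ} (hα : DifferentiableOn ℝ α U)
    (hsym : ∀ a ∈ U, ∀ x y, fderiv ℝ α a x y = fderiv ℝ α a y x) :
    ∃ f : E → ℝ, ∀ a ∈ U, HasFDerivAt f (α a) a := by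
  obtain ⟨F, _, _, ⟨e⟩⟩ : ∃ (F : Type) (_ : TopologicalSpace F) (_ : DiscreteTopology F),
      Nonempty (F ≃ ℝ) := ⟨ℝ, ⊥, @DiscreteTopology.mk ℝ ⊥ rfl, ⟨Equiv.refl ℝ⟩⟩
  exact exists_primitive_aux e hU hsc hα hsym

/-- A closed one-form on an open set whose components are simply connected is exact. -/
theorem exists_primitive_of_components {D : Set E} (hD : IsOpen D)
    (hsc : ∀ x ∈ D, IsSimplyConnected (connectedComponentIn D x)) {α : E → E →L[ℝ] ℝ}
    (hα : DifferentiableOn ℝ α D)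
    (hsym : ∀ a ∈ D, ∀ x y, fderiv ℝ α a x y = fderiv ℝ α a y x) :
    ∃ f : E → ℝ, ∀ a ∈ D, HasFDerivAt f (α a) a := by
  classical
  -- Indexing the primitives by sets rather than by points makes the choice depend only on the
  -- component, so nearby points use the same primitive.
  have h : ∀ C : Set E, ∃ f : E → ℝ, ∀ x ∈ D, C = connectedComponentIn D x →
      ∀ a ∈ C, HasFDerivAt f (α a) a := by
    intro C
    by_cases hC : ∃ x ∈ D, C = connectedComponentIn D x
    · obtain ⟨x, hx, rfl⟩ := hC
      obtain ⟨f, hf⟩ := exists_primitive_of_isSimplyConnected hD.connectedComponentIn (hsc x hx)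
        (hα.mono (connectedComponentIn_subset D x))
        fun a ha => hsym a (connectedComponentIn_subset D x ha)
      exact ⟨f, fun _ _ _ => hf⟩
    · exact ⟨0, fun x hx hCx => (hC ⟨x, hx, hCx⟩).elim⟩
  choose f hf using h
  refine ⟨fun x => f (connectedComponentIn D x) x, fun a ha => ?_⟩
  refine (hf _ a ha rfl a (mem_connectedComponentIn ha)).congr_of_eventuallyEq ?_
  filter_upwards [hD.connectedComponentIn.mem_nhds (mem_connectedComponentIn ha)] with x hx
  rw [connectedComponentIn_eq hx]

end Primitive

/-! ### Partial derivatives of functions of parameter and position -/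

section Slices

variable {E G : Type*} [NormedAddCommGroup E] [NormedSpace ℝ E] [NormedAddCommGroup G]
  [NormedSpace ℝ G] {F : ℝ → E → G}

theorem hasFDerivAt_slice {l : ℝ} {x : E}
    (hF : DifferentiableAt ℝ (fun p : ℝ × E => F p.1 p.2) (l, x)) :
    HasFDerivAt (F l)
      ((fderiv ℝ (fun p : ℝ × E => F p.1 p.2) (l, x)).comp (ContinuousLinearMap.inr ℝ ℝ E)) x :=
  HasFDerivAt.comp (g := fun p : ℝ × E => F p.1 p.2) x hF.hasFDerivAt (hasFDerivAt_prodMk_right l x)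

theorem hasDerivAt_slice {l : ℝ} {x : E}
    (hF : DifferentiableAt ℝ (fun p : ℝ × E => F p.1 p.2) (l, x)) :
    HasDerivAt (fun m => F m x) (fderiv ℝ (fun p : ℝ × E => F p.1 p.2) (l, x) (1, 0)) l :=
  HasFDerivAt.comp_hasDerivAt (l := fun p : ℝ × E => F p.1 p.2) l hF.hasFDerivAt
    ((hasDerivAt_id l).prodMk (hasDerivAt_const l x))

theorem contDiff_slice {n : WithTop ℕ∞} (hF : ContDiff ℝ n fun p : ℝ × E => F p.1 p.2) (l : ℝ) :
    ContDiff ℝ n (F l) :=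
  hF.comp (contDiff_prodMk_right l)

theorem contDiff_fderiv_slice {n m : WithTop ℕ∞} (hF : ContDiff ℝ n fun p : ℝ × E => F p.1 p.2)
    (hm : m + 1 ≤ n) : ContDiff ℝ m fun p : ℝ × E => fderiv ℝ (F p.1) p.2 := by
  have h1 : Differentiable ℝ fun p : ℝ × E => F p.1 p.2 :=
    hF.differentiable (by rintro rfl; simp at hm)
  have h2 : (fun p : ℝ × E => fderiv ℝ (F p.1) p.2) = fun p =>
      (fderiv ℝ (fun p : ℝ × E => F p.1 p.2) p).comp (ContinuousLinearMap.inr ℝ ℝ E) :=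
    funext fun p => (hasFDerivAt_slice (h1 p)).fderiv
  rw [h2]
  exact (hF.fderiv_right hm).clm_comp contDiff_const

theorem contDiff_deriv_slice {n m : WithTop ℕ∞} (hF : ContDiff ℝ n fun p : ℝ × E => F p.1 p.2)
    (hm : m + 1 ≤ n) : ContDiff ℝ m fun p : ℝ × E => deriv (fun l => F l p.2) p.1 := by
  have h1 : Differentiable ℝ fun p : ℝ × E => F p.1 p.2 :=
    hF.differentiable (by rintro rfl; simp at hm)
  have h2 : (fun p : ℝ × E => deriv (fun l => F l p.2) p.1) = fun p =>
      fderiv ℝ (fun p : ℝ × E => F p.1 p.2) p (1, 0) :=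
    funext fun p => (hasDerivAt_slice (h1 p)).deriv
  rw [h2]
  exact (hF.fderiv_right hm).clm_apply contDiff_const

/-- Symmetry of mixed partial derivatives. -/
theorem hasDerivAt_fderiv_slice (hF : ContDiff ℝ 2 fun p : ℝ × E => F p.1 p.2) (l : ℝ) (x : E) :
    HasDerivAt (fun m => fderiv ℝ (F m) x) (fderiv ℝ (fun y => deriv (fun m => F m y) l) x) l := by
  set f : ℝ × E → G := fun p => F p.1 p.2
  have h1 : Differentiable ℝ f := hF.differentiable (by norm_num)
  have h2 : Differentiable ℝ (fderiv ℝ f) :=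
    (hF.fderiv_right (m := 1) (by norm_num)).differentiable (by norm_num)
  have h3 : (fun m => fderiv ℝ (F m) x) = fun m =>
      (fderiv ℝ f (m, x)).comp (ContinuousLinearMap.inr ℝ ℝ E) :=
    funext fun m => (hasFDerivAt_slice (h1 (m, x))).fderiv
  have h4 : (fun y => deriv (fun m => F m y) l) = fun y => fderiv ℝ f (l, y) (1, 0) :=
    funext fun y => (hasDerivAt_slice (h1 (l, y))).deriv
  have h5 : HasDerivAt (fun m => fderiv ℝ f (m, x)) (fderiv ℝ (fderiv ℝ f) (l, x) (1, 0)) l :=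
    hasDerivAt_slice (F := fun m y => fderiv ℝ f (m, y)) (h2 (l, x))
  have h6 : HasFDerivAt (fun y => fderiv ℝ f (l, y))
      ((fderiv ℝ (fderiv ℝ f) (l, x)).comp (ContinuousLinearMap.inr ℝ ℝ E)) x :=
    hasFDerivAt_slice (F := fun m y => fderiv ℝ f (m, y)) (h2 (l, x))
  rw [h3, h4]
  have h7 := h5.clm_comp (hasDerivAt_const l (ContinuousLinearMap.inr ℝ ℝ E))
  have h8 := h6.clm_apply (hasFDerivAt_const ((1 : ℝ), (0 : E)) x)
  rw [h8.fderiv]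
  convert h7 using 1
  ext w
  have := hF.contDiffAt.isSymmSndFDerivAt (x := (l, x)) (by simp) (1, 0) (0, w)
  simpa using this.symm

end Slices

/-- Used to show that the pressure is differentiable across the surface of the fluid without
regularity of that surface. The increment along a segment from an outside point is controlled by the
mean value theorem on its last stretch inside `D`, where `f'` is small by continuity. -/
theorem hasFDerivAt_of_eq_zero_compl {E : Type*} [NormedAddCommGroup E] [NormedSpace ℝ E]
    {D : Set E} {f : E → ℝ} {f' : E → E →L[ℝ] ℝ} (hf : Continuous f)
    (hf' : Continuous f') (h0 : ∀ x ∉ D, f x = 0) (h0' : ∀ x ∉ D, f' x = 0)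
    (h : ∀ x ∈ D, HasFDerivAt f (f' x) x) (x : E) : HasFDerivAt f (f' x) x := by
  by_cases hx : x ∈ D
  · exact h x hx
  rw [h0' x hx]
  refine .of_isLittleO ?_
  rw [Asymptotics.isLittleO_iff]
  intro ε hε
  have hev : ∀ᶠ y in 𝓝 x, ‖f' y‖ < ε := by
    have : Tendsto (fun y => ‖f' y‖) (𝓝 x) (𝓝 0) := by
      simpa [h0' x hx] using (hf'.norm.tendsto x)
    exact this.eventually_lt_const hε
  obtain ⟨r, hr, hball⟩ := Metric.eventually_nhds_iff_ball.1 hev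
  filter_upwards [Metric.ball_mem_nhds x hr] with y hy
  rw [h0 x hx]
  simp only [sub_zero, zero_apply]
  by_cases hyD : y ∈ D
  swap
  · rw [h0 y hyD]; simp; positivity
  have hpath : Continuous fun t : ℝ => x + t • (y - x) := by fun_prop
  let c : ℝ → E := fun t => x + t • (y - x)
  -- The zeros of `f` and `f'` replace the complement of `D`: they form a closed set containing it,
  -- so a last parameter `T` exists and the segment stays in `D` after it.
  let Z : Set ℝ := Icc 0 1 ∩ {t | f (c t) = 0 ∧ f' (c t) = 0}
  have hZc : IsCompact Z := by
    refine isCompact_Icc.inter_right ?_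
    exact (isClosed_eq (hf.comp hpath) continuous_const).inter
      (isClosed_eq (hf'.comp hpath) continuous_const)
  have hZn : Z.Nonempty := ⟨0, ⟨by simp, by simp [c, h0 x hx, h0' x hx]⟩⟩
  obtain ⟨T, hT, hTmax⟩ := hZc.exists_isGreatest hZn
  rcases eq_or_lt_of_le hT.1.2 with hT1 | hT1
  · have : f y = 0 := by have := hT.2.1; simpa [hT1, c] using this
    rw [this]; simp; positivity
  have hin : ∀ t ∈ Ioo T 1, c t ∈ D := by
    intro t ht
    by_contra hcon
    have : t ∈ Z := ⟨⟨hT.1.1.trans ht.1.le, ht.2.le⟩, h0 _ hcon, h0' _ hcon⟩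
    exact absurd (hTmax this) (not_le.2 ht.1)
  have hd : ∀ t, HasDerivAt c (y - x) t := fun t => by
    exact (((hasDerivAt_id t).smul_const (y - x)).const_add x).congr_deriv (one_smul ℝ _)
  obtain ⟨t, ht, heq⟩ := exists_hasDerivAt_eq_slope (f ∘ c) (fun t => f' (c t) (y - x)) hT1
    (hf.comp hpath).continuousOn
    fun t ht => (h _ (hin t ht)).comp_hasDerivAt t (hd t)
  have hfy : f y = f' (c t) (y - x) * (1 - T) := by
    rw [heq, div_mul_cancel₀ _ (by linarith)]
    have : f (c T) = 0 := hT.2.1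
    simp [this]
    simp [c]
  have ht0 : 0 ≤ t := hT.1.1.trans ht.1.le
  have hct : c t ∈ Metric.ball x r := by
    rw [mem_ball_iff_norm] at hy ⊢
    simp only [c, add_sub_cancel_left, norm_smul, Real.norm_eq_abs, abs_of_nonneg ht0]
    exact lt_of_le_of_lt (mul_le_of_le_one_left (norm_nonneg _) ht.2.le) hy
  rw [hfy, norm_mul]
  have h1 : ‖f' (c t) (y - x)‖ ≤ ε * ‖y - x‖ :=
    (f' (c t)).le_of_opNorm_le (hball _ hct).le _
  have h2 : ‖1 - T‖ ≤ 1 := by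
    rw [Real.norm_eq_abs, abs_of_nonneg (by linarith)]; linarith [hT.1.1]
  exact (mul_le_of_le_one_right (norm_nonneg _) h2).trans h1

/-! ### The Jacobian determinant on `E3` -/

theorem det_eq_matrix_det (A : E3 →L[ℝ] E3) :
    A.det = (Matrix.of fun i j : Fin 3 => (A (EuclideanSpace.single j 1)) i).det := by
  rw [ContinuousLinearMap.det, ← LinearMap.det_toMatrix (EuclideanSpace.basisFun (Fin 3) ℝ).toBasis]
  congr 1

theorem contDiff_det {n : WithTop ℕ∞} : ContDiff ℝ n fun A : E3 →L[ℝ] E3 => A.det := by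
  have h : ∀ i j : Fin 3, ContDiff ℝ n fun A : E3 →L[ℝ] E3 =>
      (A (EuclideanSpace.single j 1)) i := fun i j => by fun_prop
  simp only [det_eq_matrix_det, Matrix.det_fin_three, Matrix.of_apply]
  fun_prop

/-- Jacobi's formula at the identity: of the six products in the determinant, only the diagonal one
has a nonzero first-order term. -/
theorem hasDerivAt_det_of_eq_id {A : ℝ → E3 →L[ℝ] E3} {A' : E3 →L[ℝ] E3} {t : ℝ}
    (hA : HasDerivAt A A' t) (h : A t = ContinuousLinearMap.id ℝ E3) :
    HasDerivAt (fun m => (A m).det) (∑ i : Fin 3, (A' (EuclideanSpace.single i 1)) i) t := by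
  have h1 : ∀ i j : Fin 3, HasDerivAt (fun m => (A m (EuclideanSpace.single j 1)) i)
      ((A' (EuclideanSpace.single j 1)) i) t := fun i j => by
    have := ((EuclideanSpace.proj (𝕜 := ℝ) i).comp
      (ContinuousLinearMap.apply ℝ E3 (EuclideanSpace.single j (1 : ℝ)))).hasFDerivAt.comp_hasDerivAt
        t hA
    exact this
  simp only [det_eq_matrix_det, Matrix.det_fin_three, Matrix.of_apply]
  have h2 := ((((((((h1 0 0).mul (h1 1 1)).mul (h1 2 2)).sub
    (((h1 0 0).mul (h1 1 2)).mul (h1 2 1))).sub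
    (((h1 0 1).mul (h1 1 0)).mul (h1 2 2))).add
    (((h1 0 1).mul (h1 1 2)).mul (h1 2 0))).add
    (((h1 0 2).mul (h1 1 0)).mul (h1 2 1))).sub
    (((h1 0 2).mul (h1 1 1)).mul (h1 2 0)))
  refine h2.congr_deriv ?_
  simp [h, Fin.sum_univ_three]

/-! ### Divergence theorems -/

theorem integral_fderiv_apply_eq_zero {g : E3 → ℝ} (hg : ContDiff ℝ 1 g)
    (hc : HasCompactSupport g) (w : E3) : ∫ x, fderiv ℝ g x w = 0 := by
  -- Integration by parts against the constant function 1.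
  have h := integral_bilinear_hasFDerivAt_right_eq_neg_left_of_integrable (μ := volume)
    (f := fun _ : E3 => (1 : ℝ)) (f' := fun _ => 0) (g := g) (g' := fderiv ℝ g) (v := w)
    (B := ContinuousLinearMap.mul ℝ ℝ) (by simp)
    (by
      simp only [ContinuousLinearMap.mul_apply', one_mul]
      exact ((hg.continuous_fderiv (by norm_num)).clm_apply continuous_const).integrable_of_hasCompactSupport
        (hc.fderiv_apply ℝ w))
    (by
      simp only [ContinuousLinearMap.mul_apply', one_mul]
      exact hg.continuous.integrable_of_hasCompactSupport hc)
    (fun x _ => hasFDerivAt_const _ _)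
    (fun x _ => (hg.differentiable (by norm_num) x).hasFDerivAt)
  simpa using h

theorem fderiv_coord_apply {F : E3 → E3} {x : E3} (hF : DifferentiableAt ℝ F x) (i : Fin 3)
    (w : E3) : fderiv ℝ (fun y => F y i) x w = (fderiv ℝ F x w) i := by
  have := ((EuclideanSpace.proj (𝕜 := ℝ) i).hasFDerivAt (x := F x)).comp x hF.hasFDerivAt
  have h2 : HasFDerivAt (fun y => F y i) ((EuclideanSpace.proj (𝕜 := ℝ) i).comp (fderiv ℝ F x)) x :=
    this
  rw [h2.fderiv]
  rfl

theorem integral_divergence_eq_zero_of_hasCompactSupport {F : E3 → E3} (hF : ContDiff ℝ 1 F)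
    (hc : HasCompactSupport F) : ∫ x, divergence F x = 0 := by
  have hi : ∀ i : Fin 3, ContDiff ℝ 1 fun x => F x i := fun i => by fun_prop
  have hci : ∀ i : Fin 3, HasCompactSupport fun x => F x i := fun i =>
    hc.comp_left (g := fun y : E3 => y i) rfl
  have h : ∀ x, divergence F x =
      ∑ i : Fin 3, fderiv ℝ (fun y => F y i) x (EuclideanSpace.single i 1) := fun x =>
    Finset.sum_congr rfl fun i _ => (fderiv_coord_apply (hF.differentiable (by norm_num) x) i _).symm
  simp_rw [h]
  rw [integral_finsetSum]
  · exact Finset.sum_eq_zero fun i _ => integral_fderiv_apply_eq_zero (hi i) (hci i) _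
  · intro i _
    exact (((hi i).continuous_fderiv (by norm_num)).clm_apply
      continuous_const).integrable_of_hasCompactSupport ((hci i).fderiv_apply ℝ _)

theorem sum_single_smul (x : E3) : ∑ i : Fin 3, x i • EuclideanSpace.single i (1 : ℝ) = x := by
  ext j
  fin_cases j <;> simp [Fin.sum_univ_three]

theorem divergence_smul {h : E3 → ℝ} {F : E3 → E3} {x : E3} (hh : DifferentiableAt ℝ h x)
    (hF : DifferentiableAt ℝ F x) :
    divergence (fun y => h y • F y) x = fderiv ℝ h x (F x) + h x * divergence F x := by
  have h1 : fderiv ℝ h x (F x) = ∑ i : Fin 3, F x i * fderiv ℝ h x (EuclideanSpace.single i 1) := by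
    conv_lhs => rw [← sum_single_smul (F x)]
    simp
  simp only [divergence, h1, fderiv_fun_smul hh hF, Finset.mul_sum, ← Finset.sum_add_distrib]
  refine Finset.sum_congr rfl fun i _ => ?_
  simp
  ring

theorem divergence_congr {F F' : E3 → E3} {x : E3} (h : F =ᶠ[𝓝 x] F') :
    divergence F x = divergence F' x := by
  simp only [divergence, h.fderiv_eq]

theorem continuous_divergence {F : E3 → E3} (hF : ContDiff ℝ 1 F) : Continuous (divergence F) := by
  have h := hF.continuous_fderiv (by norm_num)
  unfold divergence
  fun_prop

/-- The exponent 4 exceeds the dimension 3; products of two fields of order r⁻² are of this kind. -/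
theorem integrable_of_le_one_add_norm_pow_four {f : E3 → ℝ} (hf : AEStronglyMeasurable f volume)
    {C : ℝ} (h : ∀ x, |f x| ≤ C / (1 + ‖x‖) ^ 4) : Integrable f := by
  have h1 : Integrable (fun x : E3 => C * (1 + ‖x‖) ^ (-(4 : ℝ))) :=
    (integrable_one_add_norm (by norm_num)).const_mul C
  refine h1.mono' hf (ae_of_all _ fun x => ?_)
  have : (0 : ℝ) < 1 + ‖x‖ := by positivity
  rw [Real.rpow_neg this.le, Real.norm_eq_abs, ← div_eq_mul_inv]
  exact_mod_cast h x

/-- The integral of the divergence of a field that falls off like `r⁻³` vanishes. -/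
theorem integral_divergence_eq_zero_of_decay {F : E3 → E3} (hF : ContDiff ℝ 1 F) {C : ℝ}
    (hC : ∀ x, ‖F x‖ ≤ C / (1 + ‖x‖) ^ 3) (hint : Integrable (divergence F)) :
    ∫ x, divergence F x = 0 := by
  let χ : ContDiffBump (0 : E3) := ⟨1, 2, one_pos, one_lt_two⟩
  have hχ : ContDiff ℝ 1 χ := χ.contDiff
  have hχc : HasCompactSupport (fderiv ℝ χ) := χ.hasCompactSupport.fderiv ℝ
  obtain ⟨B, hB⟩ := hχc.exists_bound_of_continuous (hχ.continuous_fderiv (by norm_num))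
  have hB0 : 0 ≤ B := (norm_nonneg _).trans (hB 0)
  have hC0 : 0 ≤ C := by simpa using (norm_nonneg _).trans (hC 0)
  -- The cutoffs `χ (c n x)` equal 1 on the ball of radius n + 1 and vanish outside the ball of
  -- radius 2(n + 1); scaling by n + 1 avoids division by zero.
  let c : ℕ → E3 → E3 := fun n x => ((n : ℝ) + 1)⁻¹ • x
  have hcd : ∀ n x, HasFDerivAt (c n) (((n : ℝ) + 1)⁻¹ • ContinuousLinearMap.id ℝ E3) x :=
    fun n x => (((n : ℝ) + 1)⁻¹ • ContinuousLinearMap.id ℝ E3).hasFDerivAt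
  have hχn : ∀ n x, HasFDerivAt (fun x => χ (c n x))
      (((n : ℝ) + 1)⁻¹ • fderiv ℝ χ (c n x)) x := fun n x => by
    have := ((hχ.differentiable (by norm_num) (c n x)).hasFDerivAt).comp x (hcd n x)
    rw [ContinuousLinearMap.comp_smul, ContinuousLinearMap.comp_id] at this
    exact this
  have hχnC : ∀ n, ContDiff ℝ 1 fun x => χ (c n x) := fun n =>
    hχ.comp (contDiff_id.const_smul _)
  have hn0 : ∀ n : ℕ, (0 : ℝ) < (n : ℝ) + 1 := fun n => by positivity
  have hnorm : ∀ n x, ‖c n x‖ = ‖x‖ / (n + 1) := fun n x => by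
    simp only [c, norm_smul, norm_inv, Real.norm_eq_abs, abs_of_pos (hn0 n)]
    rw [inv_mul_eq_div]
  have hsupp : ∀ n, HasCompactSupport fun x => χ (c n x) := fun n => by
    refine HasCompactSupport.intro (isCompact_closedBall (0 : E3) (2 * (n + 1))) fun x hx => ?_
    refine χ.zero_of_le_dist ?_
    simp only [Metric.mem_closedBall, dist_zero_right, not_le] at hx
    rw [dist_zero_right, hnorm, le_div_iff₀ (hn0 n)]
    exact hx.le
  have key : ∀ n, ∫ x, χ (c n x) * divergence F x =
      - ∫ x, (((n : ℝ) + 1)⁻¹ • fderiv ℝ χ (c n x)) (F x) := by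
    intro n
    have h0 := integral_divergence_eq_zero_of_hasCompactSupport ((hχnC n).smul hF)
      ((hsupp n).smul_right)
    have h1 : ∀ x, divergence (fun x => χ (c n x) • F x) x =
        (((n : ℝ) + 1)⁻¹ • fderiv ℝ χ (c n x)) (F x) + χ (c n x) * divergence F x := fun x => by
      rw [divergence_smul (hχn n x).differentiableAt (hF.differentiable (by norm_num) x),
        (hχn n x).fderiv]
    have i1 : Integrable fun x => (((n : ℝ) + 1)⁻¹ • fderiv ℝ χ (c n x)) (F x) := by
      have : (fun x => (((n : ℝ) + 1)⁻¹ • fderiv ℝ χ (c n x)) (F x)) =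
          fun x => fderiv ℝ (fun x => χ (c n x)) x (F x) :=
        funext fun x => by rw [(hχn n x).fderiv]
      rw [this]
      refine Continuous.integrable_of_hasCompactSupport
        (((hχnC n).continuous_fderiv (by norm_num)).clm_apply hF.continuous) ?_
      refine ((hsupp n).fderiv ℝ).mono fun x hx => ?_
      contrapose! hx
      rw [Function.notMem_support] at hx ⊢
      simp [hx]
    have i2 : Integrable fun x => χ (c n x) * divergence F x :=
      Continuous.integrable_of_hasCompactSupport
        ((hχnC n).continuous.mul (continuous_divergence hF)) (hsupp n).mul_right
    have h2 : ∫ x, divergence (fun x => χ (c n x) • F x) x = 0 := h0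
    simp_rw [h1] at h2
    rw [integral_add i1 i2] at h2
    linarith
  have lim1 : Tendsto (fun n : ℕ => ∫ x, χ (c n x) * divergence F x) atTop
      (𝓝 (∫ x, divergence F x)) := by
    refine tendsto_integral_of_dominated_convergence (fun x => ‖divergence F x‖)
      (fun n => ((hχnC n).continuous.mul (continuous_divergence hF)).aestronglyMeasurable)
      hint.norm (fun n => ae_of_all _ fun x => ?_) (ae_of_all _ fun x => ?_)
    · rw [norm_mul, Real.norm_of_nonneg χ.nonneg]
      exact mul_le_of_le_one_left (norm_nonneg _) χ.le_one
    · refine tendsto_const_nhds.congr' ?_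
      obtain ⟨N, hN⟩ := exists_nat_ge ‖x‖
      filter_upwards [eventually_ge_atTop N] with n hn
      rw [χ.one_of_mem_closedBall, one_mul]
      rw [Metric.mem_closedBall, dist_zero_right, hnorm, div_le_iff₀ (hn0 n)]
      have : (N : ℝ) ≤ n := by exact_mod_cast hn
      change ‖x‖ ≤ 1 * ((n : ℝ) + 1)
      linarith
  have hz : ∀ (n : ℕ) (x : E3), ‖x‖ < n + 1 → fderiv ℝ χ (c n x) = 0 := fun n x hx => by
    have : χ =ᶠ[𝓝 (c n x)] fun _ => (1 : ℝ) := by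
      refine χ.eventuallyEq_one_of_mem_ball ?_
      rw [Metric.mem_ball, dist_zero_right, hnorm, div_lt_iff₀ (hn0 n)]
      change ‖x‖ < 1 * ((n : ℝ) + 1)
      linarith
    rw [this.fderiv_eq]
    simp
  have hz2 : ∀ (n : ℕ) (x : E3), 2 * ((n : ℝ) + 1) < ‖x‖ → fderiv ℝ χ (c n x) = 0 := fun n x hx => by
    have : χ =ᶠ[𝓝 (c n x)] fun _ => (0 : ℝ) := by
      have hout : c n x ∈ (Metric.closedBall (0 : E3) 2)ᶜ := by
        rw [mem_compl_iff, Metric.mem_closedBall, dist_zero_right, hnorm, not_le, lt_div_iff₀ (hn0 n)]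
        exact hx
      filter_upwards [Metric.isClosed_closedBall.isOpen_compl.mem_nhds hout] with y hy
      refine χ.zero_of_le_dist ?_
      rw [mem_compl_iff, Metric.mem_closedBall, not_le] at hy
      exact hy.le
    rw [this.fderiv_eq]
    simp
  have lim2 : Tendsto (fun n : ℕ => ∫ x, (((n : ℝ) + 1)⁻¹ • fderiv ℝ χ (c n x)) (F x)) atTop
      (𝓝 (∫ _ : E3, (0 : ℝ))) := by
    have hmeas : ∀ n : ℕ, AEStronglyMeasurable
        (fun x => (((n : ℝ) + 1)⁻¹ • fderiv ℝ χ (c n x)) (F x)) volume := fun n => by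
      have h1 : Continuous fun x => fderiv ℝ χ (c n x) :=
        (hχ.continuous_fderiv (by norm_num)).comp (show Continuous (c n) from continuous_const_smul _)
      exact (Continuous.clm_apply (h1.const_smul (((n : ℝ) + 1)⁻¹)) hF.continuous).aestronglyMeasurable
    -- Where the differential of the cutoff is nonzero, ‖x‖ ≤ 2(n + 1), hence 1 + ‖x‖ ≤ 3(n + 1).
    -- The factor 1/(n + 1) thus supplies the fourth power of decay, with constant 3. Pointwise the
    -- integrand is eventually zero.
    refine tendsto_integral_of_dominated_convergence (fun x => (3 * B * C) * (1 + ‖x‖) ^ (-(4 : ℝ)))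
      hmeas ((integrable_one_add_norm (by norm_num)).const_mul _)
      (fun n => ae_of_all _ fun x => ?_) (ae_of_all _ fun x => ?_)
    · have hx1 : (0 : ℝ) < 1 + ‖x‖ := by positivity
      rw [Real.rpow_neg hx1.le, ← div_eq_mul_inv]
      have e4 : (1 + ‖x‖) ^ (4 : ℝ) = (1 + ‖x‖) ^ 4 := by exact_mod_cast Real.rpow_natCast _ 4
      rw [e4]
      by_cases hx : 2 * ((n : ℝ) + 1) < ‖x‖
      · rw [hz2 n x hx]; simp; positivity
      push Not at hx
      have h3 : ((n : ℝ) + 1)⁻¹ ≤ 3 / (1 + ‖x‖) := by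
        rw [inv_eq_one_div, div_le_div_iff₀ (hn0 n) hx1]
        have : (0 : ℝ) ≤ n := by positivity
        linarith
      calc ‖(((n : ℝ) + 1)⁻¹ • fderiv ℝ χ (c n x)) (F x)‖
          ≤ ((n : ℝ) + 1)⁻¹ * (B * ‖F x‖) := by
            rw [smul_apply, norm_smul, Real.norm_of_nonneg (by positivity)]
            gcongr
            exact (fderiv ℝ χ (c n x)).le_of_opNorm_le (hB _) _
        _ ≤ 3 / (1 + ‖x‖) * (B * (C / (1 + ‖x‖) ^ 3)) := by
            gcongr
            exact hC x
        _ = 3 * B * C / (1 + ‖x‖) ^ 4 := by field_simp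
    · refine tendsto_const_nhds.congr' ?_
      obtain ⟨N, hN⟩ := exists_nat_ge ‖x‖
      filter_upwards [eventually_ge_atTop N] with n hn
      have : (N : ℝ) ≤ n := by exact_mod_cast hn
      rw [hz n x (by linarith)]
      simp
  have lim3 := lim2.neg
  simp_rw [← key] at lim3
  simpa using tendsto_nhds_unique lim1 lim3

/-! ### Gradients and Green's identity -/

/-- The Riesz representation as a linear map, which takes the differential to the gradient. -/
noncomputable def toGradient : (E3 →L[ℝ] ℝ) →L[ℝ] E3 :=
  LinearMap.toContinuousLinearMap
    { toFun := fun a => (InnerProductSpace.toDual ℝ E3).symm a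
      map_add' := fun a b => by simp
      map_smul' := fun r a => by simp }

theorem inner_gradient_left {f : E3 → ℝ} (x w : E3) :
    inner ℝ (gradient f x) w = fderiv ℝ f x w :=
  InnerProductSpace.toDual_symm_apply

theorem divergence_gradient {Φ : E3 → ℝ} (hΦ : ContDiff ℝ 2 Φ) (x : E3) :
    divergence (gradient Φ) x = Laplacian.laplacian Φ x := by
  rw [InnerProductSpace.laplacian_eq_iteratedFDeriv_orthonormalBasis Φ
    (EuclideanSpace.basisFun (Fin 3) ℝ)]
  refine Finset.sum_congr rfl fun i _ => ?_
  have h1 : Differentiable ℝ (fderiv ℝ Φ) :=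
    (hΦ.fderiv_right (m := 1) (by norm_num)).differentiable (by norm_num)
  have h2 : HasFDerivAt (gradient Φ) (toGradient.comp (fderiv ℝ (fderiv ℝ Φ) x)) x :=
    HasFDerivAt.comp x toGradient.hasFDerivAt
      (h1 x).hasFDerivAt
  rw [h2.fderiv, iteratedFDeriv_two_apply]
  simp only [EuclideanSpace.basisFun_apply, Matrix.cons_val_zero, Matrix.cons_val_one]
  have h3 : ∀ y : E3, y i = inner ℝ y (EuclideanSpace.single i (1 : ℝ)) := fun y => by
    simp [EuclideanSpace.inner_single_right]
  rw [h3]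
  exact InnerProductSpace.toDual_symm_apply

theorem contDiff_gradient {Φ : E3 → ℝ} (hΦ : ContDiff ℝ 2 Φ) : ContDiff ℝ 1 (gradient Φ) :=
  toGradient.contDiff.comp
    (hΦ.fderiv_right (m := 1) (by norm_num))

/-- Green's first identity on all of space for functions that fall off at infinity. -/
theorem integral_fderiv_gradient_eq_neg {Φ ψ : E3 → ℝ} (hΦ : ContDiff ℝ 2 Φ) (hψ : ContDiff ℝ 1 ψ)
    {C : ℝ} (h1 : ∀ x, ‖gradient Φ x‖ ≤ C / (1 + ‖x‖) ^ 2) (h2 : ∀ x, |ψ x| ≤ C / (1 + ‖x‖))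
    (h3 : Integrable fun x => fderiv ℝ ψ x (gradient Φ x))
    (h4 : Integrable fun x => ψ x * Laplacian.laplacian Φ x) :
    ∫ x, fderiv ℝ ψ x (gradient Φ x) = - ∫ x, ψ x * Laplacian.laplacian Φ x := by
  have hC0 : 0 ≤ C := by simpa using (norm_nonneg _).trans (h1 0)
  have hdiv : ∀ x, divergence (fun y => ψ y • gradient Φ y) x =
      fderiv ℝ ψ x (gradient Φ x) + ψ x * Laplacian.laplacian Φ x := fun x => by
    rw [divergence_smul (hψ.differentiable (by norm_num) x)
      ((contDiff_gradient hΦ).differentiable (by norm_num) x), divergence_gradient hΦ]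
  have h := integral_divergence_eq_zero_of_decay (F := fun y => ψ y • gradient Φ y)
    (hψ.smul (contDiff_gradient hΦ)) (C := C * C)
    (fun x => by
      rw [norm_smul, Real.norm_eq_abs]
      have hx1 : (0 : ℝ) < 1 + ‖x‖ := by positivity
      calc |ψ x| * ‖gradient Φ x‖ ≤ C / (1 + ‖x‖) * (C / (1 + ‖x‖) ^ 2) := by
            gcongr
            · exact h2 x
            · exact h1 x
        _ = C * C / (1 + ‖x‖) ^ 3 := by field_simp)
    (by
      have : divergence (fun y => ψ y • gradient Φ y) = fun x =>
          fderiv ℝ ψ x (gradient Φ x) + ψ x * Laplacian.laplacian Φ x := funext hdiv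
      rw [this]
      exact h3.add h4)
  simp_rw [hdiv] at h
  rw [integral_add h3 h4] at h
  linarith

theorem integrableOn_of_continuousOn_of_bounded {D : Set E3} (hD : IsOpen D)
    (hb : Bornology.IsBounded D) {f : E3 → ℝ} (hf : ContinuousOn f D) {C : ℝ}
    (hC : ∀ x ∈ D, |f x| ≤ C) : IntegrableOn f D :=
  (integrableOn_const hb.measure_lt_top.ne).mono' (hf.aestronglyMeasurable hD.measurableSet)
    ((ae_restrict_iff' hD.measurableSet).2 (ae_of_all _ hC))

theorem Continuous.exists_bound_of_isBounded {X G : Type*} [PseudoMetricSpace X] [ProperSpace X]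
    [NormedAddCommGroup G] {D : Set X} (hb : Bornology.IsBounded D) {f : X → G}
    (hf : Continuous f) : ∃ C : ℝ, 0 ≤ C ∧ ∀ x ∈ D, ‖f x‖ ≤ C := by
  obtain ⟨C, hC⟩ := hb.isCompact_closure.exists_bound_of_continuousOn hf.continuousOn
  exact ⟨max C 0, le_max_right _ _, fun x hx => (hC x (subset_closure hx)).trans (le_max_left _ _)⟩

/-! ### Flux of the mass current without boundary regularity -/

/-- A `C¹` function on `(0, ∞)` which vanishes on `(0, ε]` and is within `2 ε` of the identity. -/
noncomputable def cutoffId (ε t : ℝ) : ℝ := max (t - ε) 0 ^ 2 / t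

theorem hasDerivAt_max_zero_sq (t : ℝ) :
    HasDerivAt (fun s : ℝ => max s 0 ^ 2) (2 * max t 0) t := by
  rcases lt_trichotomy t 0 with h | rfl | h
  · rw [max_eq_right h.le, mul_zero]
    refine (hasDerivAt_const t (0 : ℝ)).congr_of_eventuallyEq ?_
    filter_upwards [Iio_mem_nhds h] with s hs
    simp [max_eq_right (le_of_lt (mem_Iio.1 hs))]
  · rw [max_self, mul_zero, hasDerivAt_iff_isLittleO]
    simp only [max_self, sub_zero, smul_zero]
    refine Asymptotics.isLittleO_iff.2 fun c hc => ?_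
    filter_upwards [Metric.ball_mem_nhds (0 : ℝ) hc] with s hs
    rw [mem_ball_zero_iff, Real.norm_eq_abs] at hs
    have h1 : |max s 0| ≤ |s| := by
      rcases le_total s 0 with h | h <;> simp [h]
    simp only [Real.norm_eq_abs, ne_eq, OfNat.ofNat_ne_zero, not_false_eq_true, zero_pow, sub_zero,
      abs_pow]
    nlinarith [abs_nonneg (max s 0), abs_nonneg s]
  · rw [max_eq_left h.le]
    have := (hasDerivAt_id t).pow 2
    refine (this.congr_deriv (by simp)).congr_of_eventuallyEq ?_
    filter_upwards [Ioi_mem_nhds h] with s hs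
    simp [max_eq_left (le_of_lt (mem_Ioi.1 hs))]

theorem contDiff_max_zero_sq : ContDiff ℝ 1 fun s : ℝ => max s 0 ^ 2 := by
  rw [contDiff_one_iff_deriv]
  refine ⟨fun t => (hasDerivAt_max_zero_sq t).differentiableAt, ?_⟩
  have : deriv (fun s : ℝ => max s 0 ^ 2) = fun t => 2 * max t 0 :=
    funext fun t => (hasDerivAt_max_zero_sq t).deriv
  rw [this]
  fun_prop

theorem contDiffAt_cutoffId (ε : ℝ) {t : ℝ} (ht : 0 < t) : ContDiffAt ℝ 1 (cutoffId ε) t :=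
  ContDiffAt.div (contDiff_max_zero_sq.comp (contDiff_id.sub contDiff_const)).contDiffAt
    contDiffAt_id ht.ne'

theorem deriv_cutoffId (ε : ℝ) {t : ℝ} (ht : 0 < t) :
    deriv (cutoffId ε) t = (2 * max (t - ε) 0 * t - max (t - ε) 0 ^ 2) / t ^ 2 := by
  have h1 : HasDerivAt (fun s : ℝ => max (s - ε) 0 ^ 2) (2 * max (t - ε) 0) t := by
    simpa using (hasDerivAt_max_zero_sq (t - ε)).comp_sub_const t ε
  have h2 := h1.div (hasDerivAt_id t) ht.ne'
  rw [show cutoffId ε = (fun s : ℝ => max (s - ε) 0 ^ 2) / id from rfl, h2.deriv]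
  simp

theorem cutoffId_of_le {ε t : ℝ} (h : t ≤ ε) : cutoffId ε t = 0 := by
  simp [cutoffId, max_eq_right (sub_nonpos.2 h)]

theorem abs_cutoffId_sub_le {ε t : ℝ} (hε : 0 < ε) (ht : 0 < t) : |t - cutoffId ε t| ≤ 2 * ε := by
  set m := max (t - ε) 0
  have h1 : 0 ≤ m := le_max_right _ _
  have h2 : m ≤ t := max_le (by linarith) ht.le
  have h3 : t - ε ≤ m := le_max_left _ _
  have : t - cutoffId ε t = (t - m) * (t + m) / t := by
    simp only [cutoffId]; field_simp; ring
  rw [this, abs_le, le_div_iff₀ ht, div_le_iff₀ ht]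
  constructor <;> nlinarith

/-- Replacing ρ by h(ρ) in a divergence-free current ρw leaves the divergence (h(ρ) - ρ h'(ρ)) div
w. This bound makes that error uniformly small, and is the reason for the quadratic shape of the
cutoff. -/
theorem abs_cutoffId_sub_mul_deriv_le {ε t : ℝ} (hε : 0 < ε) (ht : 0 < t) :
    |cutoffId ε t - t * deriv (cutoffId ε) t| ≤ 2 * ε := by
  rw [deriv_cutoffId ε ht]
  simp only [cutoffId]
  set m := max (t - ε) 0
  have h1 : 0 ≤ m := le_max_right _ _
  have h2 : m ≤ t := max_le (by linarith) ht.le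
  have h3 : t - ε ≤ m := le_max_left _ _
  have : m ^ 2 / t - t * ((2 * m * t - m ^ 2) / t ^ 2) = 2 * m * (m - t) / t := by
    field_simp; ring
  rw [this, abs_le, le_div_iff₀ ht, div_le_iff₀ ht]
  constructor <;> nlinarith

/-- A stationary mass current `ρ w` with continuous density has no net flux against the gradient of
a bounded function with bounded gradient. -/
theorem integral_mul_fderiv_eq_zero_of_bounded {ρ : E3 → ℝ} {w : E3 → E3} {D : Set E3}
    (hρ : Continuous ρ) (hD : D = {x | 0 < ρ x}) (hb : Bornology.IsBounded D)
    (hρ0 : ∀ x, 0 ≤ ρ x) (hρD : ContDiffOn ℝ 1 ρ D) (hw : ContDiff ℝ 1 w)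
    (hdiv : ∀ x ∈ D, fderiv ℝ ρ x (w x) + ρ x * divergence w x = 0)
    {f : E3 → ℝ} (hf : ContDiffOn ℝ 1 f D) {M : ℝ} (hM : ∀ x ∈ D, |f x| ≤ M)
    (hM' : ∀ x ∈ D, ‖fderiv ℝ f x‖ ≤ M) :
    ∫ x in D, ρ x * fderiv ℝ f x (w x) = 0 := by
  have hDo : IsOpen D := by rw [hD]; exact isOpen_lt continuous_const hρ
  have hmem : ∀ x, x ∈ D ↔ 0 < ρ x := fun x => by rw [hD]; rfl
  have hout : ∀ x ∉ D, ρ x = 0 := fun x hx =>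
    le_antisymm (not_lt.1 ((hmem x).not.1 hx)) (hρ0 x)
  obtain ⟨A, hA0, hA⟩ := Continuous.exists_bound_of_isBounded hb hw.continuous
  obtain ⟨A', hA'0, hA'⟩ := Continuous.exists_bound_of_isBounded hb (continuous_divergence hw)
  obtain ⟨R, hR0, hR⟩ := Continuous.exists_bound_of_isBounded hb hρ
  have hfc : ContinuousOn (fun x => fderiv ℝ f x (w x)) D :=
    (hf.continuousOn_fderiv_of_isOpen hDo (by norm_num)).clm_apply hw.continuous.continuousOn
  have hfw : ∀ x ∈ D, |fderiv ℝ f x (w x)| ≤ M * A := fun x hx => by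
    have h1 := (fderiv ℝ f x).le_of_opNorm_le (hM' x hx) (w x)
    have h2 := hA x hx
    have h3 : 0 ≤ M := (norm_nonneg _).trans (hM' x hx)
    exact h1.trans (by gcongr)
  have hint : IntegrableOn (fun x => ρ x * fderiv ℝ f x (w x)) D :=
    integrableOn_of_continuousOn_of_bounded hDo hb (hρ.continuousOn.mul hfc) (C := R * (M * A))
      fun x hx => by
        rw [abs_mul]
        exact mul_le_mul (hR x hx) (hfw x hx) (abs_nonneg _) hR0
  have main : ∀ ε > 0, |∫ x in D, ρ x * fderiv ℝ f x (w x)| ≤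
      ε * (2 * (M * A + M * A') * volume.real D) := by
    intro ε hε
    -- The cutoff makes the field vanish near every point outside the fluid, so it is C¹ with
    -- compact support on all of space and its divergence integrates to zero.
    let F : E3 → E3 := fun x => (cutoffId ε (ρ x) * f x) • w x
    have hzero : ∀ x ∉ D, F =ᶠ[𝓝 x] fun _ => 0 := fun x hx => by
      have : ∀ᶠ y in 𝓝 x, ρ y < ε :=
        hρ.continuousAt.eventually_lt continuousAt_const (by rw [hout x hx]; exact hε)
      filter_upwards [this] with y hy
      simp [F, cutoffId_of_le hy.le]
    have hcoef : ∀ x ∈ D, ContDiffAt ℝ 1 (fun x => cutoffId ε (ρ x) * f x) x := fun x hx =>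
      (ContDiffAt.comp x (contDiffAt_cutoffId ε ((hmem x).1 hx))
        (hρD.contDiffAt (hDo.mem_nhds hx))).mul (hf.contDiffAt (hDo.mem_nhds hx))
    have hF : ContDiff ℝ 1 F := by
      rw [contDiff_iff_contDiffAt]
      intro x
      by_cases hx : x ∈ D
      · exact (hcoef x hx).smul hw.contDiffAt
      · exact contDiffAt_const.congr_of_eventuallyEq (hzero x hx)
    have hFc : HasCompactSupport F :=
      HasCompactSupport.intro hb.isCompact_closure fun x hx =>
        (hzero x fun h => hx (subset_closure h)).self_of_nhds
    have hFdiv : ∀ x ∉ D, divergence F x = 0 := fun x hx => by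
      rw [divergence_congr (hzero x hx)]
      simp [divergence]
    have hFdivD : ∀ x ∈ D, divergence F x =
        (cutoffId ε (ρ x) - ρ x * deriv (cutoffId ε) (ρ x)) * (f x * divergence w x) +
          cutoffId ε (ρ x) * fderiv ℝ f x (w x) := fun x hx => by
      have hρx : HasFDerivAt ρ (fderiv ℝ ρ x) x :=
        ((hρD.contDiffAt (hDo.mem_nhds hx)).differentiableAt (by norm_num)).hasFDerivAt
      have hfx : HasFDerivAt f (fderiv ℝ f x) x :=
        ((hf.contDiffAt (hDo.mem_nhds hx)).differentiableAt (by norm_num)).hasFDerivAt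
      have hcx : HasDerivAt (cutoffId ε) (deriv (cutoffId ε) (ρ x)) (ρ x) :=
        ((contDiffAt_cutoffId ε ((hmem x).1 hx)).differentiableAt (by norm_num)).hasDerivAt
      have h1 := (hcx.comp_hasFDerivAt x hρx).mul hfx
      have h1' : HasFDerivAt (fun x => cutoffId ε (ρ x) * f x) _ x := h1
      rw [divergence_smul ((hcoef x hx).differentiableAt (by norm_num))
        (hw.differentiable (by norm_num) x), h1'.fderiv]
      have h2 : fderiv ℝ ρ x (w x) = - (ρ x * divergence w x) := by linarith [hdiv x hx]
      simp [h2]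
      ring
    have hFint : IntegrableOn (divergence F) D := by
      obtain ⟨B, -, hB⟩ := Continuous.exists_bound_of_isBounded hb (continuous_divergence hF)
      exact integrableOn_of_continuousOn_of_bounded hDo hb (continuous_divergence hF).continuousOn hB
    have h0 : ∫ x in D, divergence F x = 0 := by
      rw [setIntegral_eq_integral_of_forall_compl_eq_zero hFdiv]
      exact integral_divergence_eq_zero_of_hasCompactSupport hF hFc
    have h1 : ∫ x in D, ρ x * fderiv ℝ f x (w x) =
        ∫ x in D, (ρ x * fderiv ℝ f x (w x) - divergence F x) := by
      rw [integral_sub hint hFint, h0, sub_zero]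
    rw [h1]
    have h2 := norm_setIntegral_le_of_norm_le_const (μ := volume) (s := D)
      (f := fun x => ρ x * fderiv ℝ f x (w x) - divergence F x)
      (C := 2 * ε * (M * A + M * A')) hb.measure_lt_top (fun x hx => ?_)
    · rw [Real.norm_eq_abs] at h2
      linarith
    · have hρx := (hmem x).1 hx
      rw [hFdivD x hx, Real.norm_eq_abs]
      have e1 := abs_cutoffId_sub_le hε hρx
      have e2 := abs_cutoffId_sub_mul_deriv_le hε hρx
      have e3 : |f x * divergence w x| ≤ M * A' := by
        rw [abs_mul]
        exact mul_le_mul (hM x hx) (hA' x hx) (abs_nonneg _) ((abs_nonneg _).trans (hM x hx))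
      calc _ = |(ρ x - cutoffId ε (ρ x)) * fderiv ℝ f x (w x) -
            (cutoffId ε (ρ x) - ρ x * deriv (cutoffId ε) (ρ x)) * (f x * divergence w x)| := by
            congr 1; ring
        _ ≤ |ρ x - cutoffId ε (ρ x)| * |fderiv ℝ f x (w x)| +
            |cutoffId ε (ρ x) - ρ x * deriv (cutoffId ε) (ρ x)| * |f x * divergence w x| := by
            rw [← abs_mul, ← abs_mul]; exact abs_sub _ _
        _ ≤ 2 * ε * (M * A) + 2 * ε * (M * A') := by
            have := hfw x hx
            gcongr
        _ = _ := by ring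
  set K := 2 * (M * A + M * A') * volume.real D
  by_contra hne
  have hpos : 0 < |∫ x in D, ρ x * fderiv ℝ f x (w x)| := abs_pos.2 hne
  have hKpos : 0 < K := by
    have := main 1 one_pos
    linarith
  -- This `ε` bounds the integral by half of itself.
  have := main (|∫ x in D, ρ x * fderiv ℝ f x (w x)| / (2 * K)) (by positivity)
  rw [div_mul_eq_mul_div, le_div_iff₀ (by positivity)] at this
  nlinarith

/-- A stationary mass current `ρ w` with continuous density has no net flux against a bounded
gradient; the potential itself may be unbounded near the surface of the fluid. -/
theorem integral_mul_fderiv_eq_zero {ρ : E3 → ℝ} {w : E3 → E3} {D : Set E3}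
    (hρ : Continuous ρ) (hD : D = {x | 0 < ρ x}) (hb : Bornology.IsBounded D)
    (hρ0 : ∀ x, 0 ≤ ρ x) (hρD : ContDiffOn ℝ 1 ρ D) (hw : ContDiff ℝ 1 w)
    (hdiv : ∀ x ∈ D, fderiv ℝ ρ x (w x) + ρ x * divergence w x = 0)
    {f : E3 → ℝ} (hf : ContDiffOn ℝ 1 f D) {M : ℝ} (hM : ∀ x ∈ D, ‖fderiv ℝ f x‖ ≤ M) :
    ∫ x in D, ρ x * fderiv ℝ f x (w x) = 0 := by
  have hDo : IsOpen D := by rw [hD]; exact isOpen_lt continuous_const hρ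
  obtain ⟨A, hA0, hA⟩ := Continuous.exists_bound_of_isBounded hb hw.continuous
  obtain ⟨R, hR0, hR⟩ := Continuous.exists_bound_of_isBounded hb hρ
  have hfx : ∀ x ∈ D, HasFDerivAt f (fderiv ℝ f x) x := fun x hx =>
    ((hf.contDiffAt (hDo.mem_nhds hx)).differentiableAt (by norm_num)).hasFDerivAt
  have hfc : ContinuousOn (fun x => fderiv ℝ f x (w x)) D :=
    (hf.continuousOn_fderiv_of_isOpen hDo (by norm_num)).clm_apply hw.continuous.continuousOn
  let N : ℕ → ℝ := fun n => (n : ℝ) + 1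
  have hN : ∀ n, 0 < N n := fun n => by positivity
  -- A smooth truncation of `f`: each `g n` is bounded, its differential is that of `f` times a
  -- factor in [0, 1], and this factor tends to 1 pointwise. Dominated convergence then removes the
  -- truncation.
  let g : ℕ → E3 → ℝ := fun n x => N n * Real.arctan (f x / N n)
  have hg : ∀ n, ∀ x ∈ D, HasFDerivAt (g n) ((1 / (1 + (f x / N n) ^ 2)) • fderiv ℝ f x) x := by
    intro n x hx
    have h1 : HasDerivAt (fun t => N n * Real.arctan (t / N n)) (1 / (1 + (f x / N n) ^ 2)) (f x) := by
      have := ((Real.hasDerivAt_arctan (f x / N n)).comp (f x)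
        ((hasDerivAt_id (f x)).div_const (N n))).const_mul (N n)
      refine this.congr_deriv ?_
      have := (hN n).ne'
      field_simp
    exact h1.comp_hasFDerivAt x (hfx x hx)
  have hfac : ∀ n x, 0 ≤ 1 / (1 + (f x / N n) ^ 2) ∧ 1 / (1 + (f x / N n) ^ 2) ≤ 1 := fun n x => by
    refine ⟨by positivity, ?_⟩
    rw [div_le_one (by positivity)]
    nlinarith [sq_nonneg (f x / N n)]
  have hz : ∀ n, ∫ x in D, ρ x * ((1 / (1 + (f x / N n) ^ 2)) * fderiv ℝ f x (w x)) = 0 := by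
    intro n
    have h1 := integral_mul_fderiv_eq_zero_of_bounded hρ hD hb hρ0 hρD hw hdiv (f := g n)
      (contDiffOn_const.mul (Real.contDiff_arctan.comp_contDiffOn (hf.div_const _)))
      (M := max (N n * (Real.pi / 2)) M)
      (fun x _ => le_max_of_le_left (by
        simp only [g]
        rw [abs_mul, abs_of_pos (hN n)]
        gcongr
        exact abs_le.2 ⟨(Real.neg_pi_div_two_lt_arctan _).le, (Real.arctan_lt_pi_div_two _).le⟩))
      (fun x hx => le_max_of_le_right (by
        rw [(hg n x hx).fderiv, norm_smul, Real.norm_of_nonneg (hfac n x).1]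
        exact (mul_le_of_le_one_left (norm_nonneg _) (hfac n x).2).trans (hM x hx)))
    rw [← h1]
    refine setIntegral_congr_fun hDo.measurableSet fun x hx => ?_
    simp only [(hg n x hx).fderiv]
    rfl
  have hlim : Tendsto (fun n => ∫ x in D, ρ x * ((1 / (1 + (f x / N n) ^ 2)) * fderiv ℝ f x (w x)))
      atTop (𝓝 (∫ x in D, ρ x * fderiv ℝ f x (w x))) := by
    refine tendsto_integral_of_dominated_convergence (fun _ => R * (M * A)) (fun n => ?_)
      (integrableOn_const hb.measure_lt_top.ne) (fun n => ?_) ?_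
    · refine ContinuousOn.aestronglyMeasurable ?_ hDo.measurableSet
      refine hρ.continuousOn.mul (ContinuousOn.mul ?_ hfc)
      refine continuousOn_const.div ?_ fun x _ => by positivity
      exact continuousOn_const.add ((hf.continuousOn.div_const _).pow 2)
    · refine (ae_restrict_iff' hDo.measurableSet).2 (ae_of_all _ fun x hx => ?_)
      have h1 := (fderiv ℝ f x).le_of_opNorm_le (hM x hx) (w x)
      have h2 := hA x hx
      have h3 : 0 ≤ M := (norm_nonneg _).trans (hM x hx)
      rw [norm_mul, norm_mul, Real.norm_of_nonneg (hfac n x).1]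
      refine mul_le_mul (hR x hx) ?_ (by have := (hfac n x).1; positivity) hR0
      refine (mul_le_of_le_one_left (norm_nonneg _) (hfac n x).2).trans (h1.trans ?_)
      gcongr
    · refine (ae_restrict_iff' hDo.measurableSet).2 (ae_of_all _ fun x hx => ?_)
      have h1 : Tendsto (fun n => f x / N n) atTop (𝓝 0) :=
        tendsto_const_nhds.div_atTop
          (tendsto_atTop_add_const_right _ _ tendsto_natCast_atTop_atTop)
      have h2 : Tendsto (fun n => 1 / (1 + (f x / N n) ^ 2)) atTop (𝓝 1) := by
        have := (tendsto_const_nhds (x := (1 : ℝ))).div ((tendsto_const_nhds (x := (1 : ℝ))).add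
          (h1.pow 2)) (by norm_num)
        rw [zero_pow two_ne_zero, add_zero, div_one] at this
        exact this
      simpa using (h2.mul_const (fderiv ℝ f x (w x))).const_mul (ρ x)
  simp_rw [hz] at hlim
  exact tendsto_nhds_unique hlim tendsto_const_nhds

/-! ### Derivatives of integrals over the moving fluid -/

namespace IsPerturbation

variable {S : ℝ → FluidState} {Ψ : ℝ → E3 → E3}

theorem contDiff_jacobian (hS : IsPerturbation S Ψ) :
    ContDiff ℝ 2 fun p : ℝ × E3 => (fderiv ℝ (Ψ p.1) p.2).det :=
  contDiff_det.comp (contDiff_fderiv_slice hS.map_contDiff (by norm_num))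

theorem fderiv_map_zero (hS : IsPerturbation S Ψ) (x : E3) :
    fderiv ℝ (Ψ 0) x = ContinuousLinearMap.id ℝ E3 := by
  rw [show Ψ 0 = id from funext hS.map_zero, fderiv_id]

theorem jacobian_zero (hS : IsPerturbation S Ψ) (x : E3) : (fderiv ℝ (Ψ 0) x).det = 1 := by
  rw [hS.fderiv_map_zero]
  simp [ContinuousLinearMap.det]

/-- The determinant is continuous in the parameter, never zero, and 1 at the identity. Hence no
absolute value is needed in the change of variables, and the Jacobian can be differentiated
directly. -/
theorem jacobian_pos (hS : IsPerturbation S Ψ) (l : ℝ) (x : E3) :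
    0 < (fderiv ℝ (Ψ l) x).det := by
  by_contra! h
  have hc : Continuous fun m => (fderiv ℝ (Ψ m) x).det :=
    hS.contDiff_jacobian.continuous.comp (by fun_prop : Continuous fun m : ℝ => (m, x))
  obtain ⟨m, hm⟩ := mem_range_of_exists_le_of_exists_ge (c := (0 : ℝ)) hc ⟨l, h⟩
    ⟨0, by rw [hS.jacobian_zero]; exact zero_le_one⟩
  exact hS.map_det_ne_zero m x hm

theorem hasFDerivAt_map (hS : IsPerturbation S Ψ) (l : ℝ) (x : E3) :
    HasFDerivAt (Ψ l) (fderiv ℝ (Ψ l) x) x :=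
  ((contDiff_slice hS.map_contDiff l).differentiable (by norm_num) x).hasFDerivAt

theorem integral_eq_integral_pullback (hS : IsPerturbation S Ψ) (l : ℝ) (f : E3 → ℝ) :
    ∫ y, f y = ∫ x, f (Ψ l x) * (fderiv ℝ (Ψ l) x).det := by
  have h := integral_image_eq_integral_abs_det_fderiv_smul volume MeasurableSet.univ
    (fun x _ => (hS.hasFDerivAt_map l x).hasFDerivWithinAt) (hS.map_bijective l).1.injOn f
  rw [image_univ, (hS.map_bijective l).2.range_eq] at h
  simp only [Measure.restrict_univ] at h
  rw [h]
  refine integral_congr_ae (ae_of_all _ fun x => ?_)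
  simp only [abs_of_pos (hS.jacobian_pos l x), smul_eq_mul, mul_comm]

theorem integrable_iff_integrable_pullback (hS : IsPerturbation S Ψ) (l : ℝ) (f : E3 → ℝ) :
    Integrable f ↔ Integrable fun x => f (Ψ l x) * (fderiv ℝ (Ψ l) x).det := by
  have h := integrableOn_image_iff_integrableOn_abs_det_fderiv_smul volume MeasurableSet.univ
    (fun x _ => (hS.hasFDerivAt_map l x).hasFDerivWithinAt) (hS.map_bijective l).1.injOn f
  rw [image_univ, (hS.map_bijective l).2.range_eq, integrableOn_univ, integrableOn_univ] at h
  rw [h]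
  simp only [abs_of_pos (hS.jacobian_pos l _), smul_eq_mul, mul_comm]

/-- Differentiation of the integral of a quantity carried by the fluid. -/
theorem hasDerivAt_integral_of_pullback (hS : IsPerturbation S Ψ) (hDo : IsOpen (S 0).region)
    (hb : Bornology.IsBounded (S 0).region) {f g' : ℝ → E3 → ℝ} {B : ℝ}
    (hout : ∀ l, ∀ y ∉ (S l).region, f l y = 0)
    (hg : ∀ l, ∀ x ∈ (S 0).region,
      HasDerivAt (fun m => f m (Ψ m x) * (fderiv ℝ (Ψ m) x).det) (g' l x) l)
    (hgc : ∀ l, ContinuousOn (fun x => f l (Ψ l x) * (fderiv ℝ (Ψ l) x).det) (S 0).region)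
    (hgB : ∀ l ∈ Icc (-1 : ℝ) 1, ∀ x ∈ (S 0).region,
      |f l (Ψ l x) * (fderiv ℝ (Ψ l) x).det| ≤ B)
    (hg'c : ContinuousOn (g' 0) (S 0).region)
    (hg'B : ∀ l ∈ Icc (-1 : ℝ) 1, ∀ x ∈ (S 0).region, |g' l x| ≤ B) :
    (∀ l ∈ Icc (-1 : ℝ) 1, Integrable (f l)) ∧ IntegrableOn (g' 0) (S 0).region ∧
      HasDerivAt (fun l => ∫ x, f l x) (∫ x in (S 0).region, g' 0 x) 0 := by
  have hz : ∀ l, ∀ x ∉ (S 0).region, f l (Ψ l x) * (fderiv ℝ (Ψ l) x).det = 0 := fun l x hx => by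
    rw [hout l _ ((hS.map_region l x).not.2 hx), zero_mul]
  have hon : ∀ l ∈ Icc (-1 : ℝ) 1,
      IntegrableOn (fun x => f l (Ψ l x) * (fderiv ℝ (Ψ l) x).det) (S 0).region := fun l hl =>
    integrableOn_of_continuousOn_of_bounded hDo hb (hgc l) (hgB l hl)
  refine ⟨fun l hl => ?_, ?_⟩
  · rw [hS.integrable_iff_integrable_pullback l,
      ← integrableOn_iff_integrable_of_support_subset (s := (S 0).region)]
    · exact hon l hl
    · exact Function.support_subset_iff'.2 (hz l)
  · have heq : (fun l => ∫ x, f l x) = fun l =>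
        ∫ x in (S 0).region, f l (Ψ l x) * (fderiv ℝ (Ψ l) x).det := funext fun l => by
      rw [hS.integral_eq_integral_pullback l, setIntegral_eq_integral_of_forall_compl_eq_zero (hz l)]
    rw [heq]
    refine hasDerivAt_integral_of_dominated_loc_of_deriv_le (bound := fun _ => B)
      (Icc_mem_nhds (by norm_num) (by norm_num) : Icc (-1 : ℝ) 1 ∈ 𝓝 0)
      (Eventually.of_forall fun l => (hgc l).aestronglyMeasurable hDo.measurableSet)
      (hon 0 (by norm_num)) (hg'c.aestronglyMeasurable hDo.measurableSet) ?_
      (integrableOn_const hb.measure_lt_top.ne) ?_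
    · exact (ae_restrict_iff' hDo.measurableSet).2 (ae_of_all _ fun x hx l hl => hg'B l hl x hx)
    · exact (ae_restrict_iff' hDo.measurableSet).2 (ae_of_all _ fun x hx l _ => hg l x hx)

/-- The density of fluid elements is jointly continuous. -/
theorem continuous_density_pullback (hS : IsPerturbation S Ψ) (hρ : Continuous (S 0).ρ) :
    Continuous fun p : ℝ × E3 => (S p.1).ρ (Ψ p.1 p.2) := by
  -- Only the parameter derivative is assumed jointly continuous; integrating it from the continuous
  -- density at parameter 0 recovers joint continuity of the density itself.
  have h1 : ∀ p : ℝ × E3, (S p.1).ρ (Ψ p.1 p.2) = (S 0).ρ p.2 +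
      ∫ l in (0 : ℝ)..p.1, deriv (fun m => (S m).ρ (Ψ m p.2)) l := fun p => by
    rw [intervalIntegral.integral_deriv_eq_sub (fun l _ => hS.density_differentiable p.2 l)
      ((hS.density_deriv_continuous.comp
        (by fun_prop : Continuous fun m : ℝ => (m, p.2))).intervalIntegrable _ _), hS.map_zero]
    ring
  simp_rw [h1]
  refine (hρ.comp continuous_snd).add ?_
  exact intervalIntegral.continuous_parametric_intervalIntegral_of_continuous
    (f := fun (p : ℝ × E3) l => deriv (fun m => (S m).ρ (Ψ m p.2)) l)
    (hS.density_deriv_continuous.comp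
      (by fun_prop : Continuous fun q : (ℝ × E3) × ℝ => (q.2, q.1.2))) continuous_fst

theorem hasDerivAt_density_pullback (hS : IsPerturbation S Ψ) (l : ℝ) (x : E3) :
    HasDerivAt (fun m => (S m).ρ (Ψ m x)) (deriv (fun m => (S m).ρ (Ψ m x)) l) l :=
  (hS.density_differentiable x l).hasDerivAt

theorem hasDerivAt_jacobian (hS : IsPerturbation S Ψ) (l : ℝ) (x : E3) :
    HasDerivAt (fun m => (fderiv ℝ (Ψ m) x).det)
      (deriv (fun m => (fderiv ℝ (Ψ m) x).det) l) l :=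
  (hasDerivAt_slice (F := fun m x => (fderiv ℝ (Ψ m) x).det)
    (hS.contDiff_jacobian.differentiable (by norm_num) (l, x))).differentiableAt.hasDerivAt

theorem continuous_deriv_jacobian (hS : IsPerturbation S Ψ) :
    Continuous fun p : ℝ × E3 => deriv (fun m => (fderiv ℝ (Ψ m) p.2).det) p.1 :=
  (contDiff_deriv_slice (m := 1) (F := fun m x => (fderiv ℝ (Ψ m) x).det)
    hS.contDiff_jacobian (by norm_num)).continuous

theorem deriv_jacobian_zero (hS : IsPerturbation S Ψ) (x : E3) :
    deriv (fun m => (fderiv ℝ (Ψ m) x).det) 0 =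
      divergence (fun y => deriv (fun m => Ψ m y) 0) x :=
  (hasDerivAt_det_of_eq_id
    (hasDerivAt_fderiv_slice (hS.map_contDiff.of_le (by norm_num)) 0 x) (hS.fderiv_map_zero x)).deriv

theorem lagMass_eq (hS : IsPerturbation S Ψ) (x : E3) :
    lagMass S Ψ x = deriv (fun m => (S m).ρ (Ψ m x)) 0 +
      (S 0).ρ x * divergence (fun y => deriv (fun m => Ψ m y) 0) x := by
  have h := (hS.hasDerivAt_density_pullback 0 x).mul (hS.hasDerivAt_jacobian 0 x)
  rw [hS.jacobian_zero, hS.map_zero, mul_one, hS.deriv_jacobian_zero] at h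
  exact h.deriv

theorem continuous_lagMass (hS : IsPerturbation S Ψ) (hρ : Continuous (S 0).ρ) :
    Continuous (lagMass S Ψ) := by
  rw [show lagMass S Ψ = _ from funext hS.lagMass_eq]
  have h1 : Continuous fun x => deriv (fun m => (S m).ρ (Ψ m x)) 0 :=
    hS.density_deriv_continuous.comp (by fun_prop : Continuous fun x : E3 => ((0 : ℝ), x))
  have h2 : Continuous fun x => deriv (fun m => (fderiv ℝ (Ψ m) x).det) 0 :=
    hS.continuous_deriv_jacobian.comp (by fun_prop : Continuous fun x : E3 => ((0 : ℝ), x))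
  simp_rw [hS.deriv_jacobian_zero] at h2
  exact h1.add (hρ.mul h2)

theorem density_eq_zero (hS : IsPerturbation S Ψ) {l : ℝ} {y : E3} (hy : y ∉ (S l).region) :
    (S l).ρ y = 0 :=
  le_antisymm (not_lt.1 hy) (hS.density_nonneg l y)

theorem contDiff_pullback (hS : IsPerturbation S Ψ) {G : Type*} [NormedAddCommGroup G]
    [NormedSpace ℝ G] {n : WithTop ℕ∞} (hn : n ≤ 3) {q : ℝ → E3 → G}
    (hq : ContDiff ℝ n fun p : ℝ × E3 => q p.1 p.2) :
    ContDiff ℝ n fun p : ℝ × E3 => q p.1 (Ψ p.1 p.2) :=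
  hq.comp (contDiff_fst.prodMk (hS.map_contDiff.of_le hn))

theorem exists_bound (hb : Bornology.IsBounded (S 0).region) {f : ℝ × E3 → ℝ}
    (hf : Continuous f) :
    ∃ B, 0 ≤ B ∧ ∀ l ∈ Icc (-1 : ℝ) 1, ∀ x ∈ (S 0).region, |f (l, x)| ≤ B := by
  obtain ⟨B, hB0, hB⟩ := Continuous.exists_bound_of_isBounded
    ((Metric.isBounded_Icc (-1 : ℝ) 1).prod hb) hf
  exact ⟨B, hB0, fun l hl x hx => hB (l, x) ⟨hl, hx⟩⟩

/-- First variation of the integral of a smooth quantity against the mass density. -/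
theorem hasDerivAt_integral_density_mul (hS : IsPerturbation S Ψ) (hρ : Continuous (S 0).ρ)
    (hDo : IsOpen (S 0).region) (hb : Bornology.IsBounded (S 0).region) {q : ℝ → E3 → ℝ}
    (hq : ContDiff ℝ 1 fun p : ℝ × E3 => q p.1 p.2) :
    (∀ l ∈ Icc (-1 : ℝ) 1, Integrable fun y => (S l).ρ y * q l y) ∧
    IntegrableOn (fun x => lagMass S Ψ x * q 0 x +
      (S 0).ρ x * deriv (fun m => q m (Ψ m x)) 0) (S 0).region ∧
    HasDerivAt (fun l => ∫ y, (S l).ρ y * q l y)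
      (∫ x in (S 0).region, (lagMass S Ψ x * q 0 x +
        (S 0).ρ x * deriv (fun m => q m (Ψ m x)) 0)) 0 := by
  have hr := hS.continuous_density_pullback hρ
  have hr' := hS.density_deriv_continuous
  have hJ := hS.contDiff_jacobian.continuous
  have hJ' := hS.continuous_deriv_jacobian
  have hq1 := hS.contDiff_pullback (by norm_num) hq
  have hqc := hq1.continuous
  have hq' : Continuous fun p : ℝ × E3 => deriv (fun m => q m (Ψ m p.2)) p.1 :=
    (contDiff_deriv_slice (m := 0) (F := fun m x => q m (Ψ m x)) hq1 (by norm_num)).continuous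
  have hqd : ∀ l x, HasDerivAt (fun m => q m (Ψ m x)) (deriv (fun m => q m (Ψ m x)) l) l :=
    fun l x => (hasDerivAt_slice (F := fun m x => q m (Ψ m x))
      (hq1.differentiable (by norm_num) (l, x))).differentiableAt.hasDerivAt
  let g' : ℝ → E3 → ℝ := fun l x =>
    (deriv (fun m => (S m).ρ (Ψ m x)) l * q l (Ψ l x) +
      (S l).ρ (Ψ l x) * deriv (fun m => q m (Ψ m x)) l) * (fderiv ℝ (Ψ l) x).det +
    (S l).ρ (Ψ l x) * q l (Ψ l x) * deriv (fun m => (fderiv ℝ (Ψ m) x).det) l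
  have hg'c : Continuous fun p : ℝ × E3 => g' p.1 p.2 :=
    (((hr'.mul hqc).add (hr.mul hq')).mul hJ).add ((hr.mul hqc).mul hJ')
  have hgc : Continuous fun p : ℝ × E3 =>
      (S p.1).ρ (Ψ p.1 p.2) * q p.1 (Ψ p.1 p.2) * (fderiv ℝ (Ψ p.1) p.2).det :=
    (hr.mul hqc).mul hJ
  obtain ⟨B1, -, hB1⟩ := exists_bound hb hgc
  obtain ⟨B2, -, hB2⟩ := exists_bound hb hg'c
  have hg0 : g' 0 = fun x => lagMass S Ψ x * q 0 x +
      (S 0).ρ x * deriv (fun m => q m (Ψ m x)) 0 := funext fun x => by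
    simp only [g', hS.lagMass_eq, hS.jacobian_zero, hS.map_zero, hS.deriv_jacobian_zero]
    ring
  have hslice : ∀ l : ℝ, Continuous fun x : E3 => (l, x) := fun l => by fun_prop
  rw [← hg0]
  exact hS.hasDerivAt_integral_of_pullback hDo hb (f := fun l y => (S l).ρ y * q l y) (g' := g')
    (B := max B1 B2) (fun l y hy => by simp only [hS.density_eq_zero hy, zero_mul])
    (fun l x _ => ((hS.hasDerivAt_density_pullback l x).mul (hqd l x)).mul
      (hS.hasDerivAt_jacobian l x))
    (fun l => (hgc.comp (hslice l)).continuousOn)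
    (fun l hl x hx => (hB1 l hl x hx).trans (le_max_left _ _))
    (hg'c.comp (hslice 0)).continuousOn
    (fun l hl x hx => (hB2 l hl x hx).trans (le_max_right _ _))

end IsPerturbation

/-! ### First variation of the internal energy -/

theorem hasFDerivAt_eos {u : ℝ → ℝ → ℝ} (hu : IsRegularEOS u) {r : ℝ} (hr : 0 < r) (s : ℝ) :
    HasFDerivAt (fun p : ℝ × ℝ => u p.1 p.2)
      (fderiv ℝ (fun p : ℝ × ℝ => u p.1 p.2) (r, s)) (r, s) :=
  ((hu.contDiffOn.contDiffAt ((isOpen_Ioi.prod isOpen_univ).mem_nhds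
    (mk_mem_prod (mem_Ioi.2 hr) (mem_univ s)))).differentiableAt (by norm_num)).hasFDerivAt

/-- The thermodynamic relation du = (P/ρ²) dρ + T ds. -/
theorem fderiv_eos_apply {u : ℝ → ℝ → ℝ} (hu : IsRegularEOS u) {r : ℝ} (hr : 0 < r) (s a b : ℝ) :
    fderiv ℝ (fun p : ℝ × ℝ => u p.1 p.2) (r, s) (a, b) =
      pressure u r s / r ^ 2 * a + temperature u r s * b := by
  have h := hasFDerivAt_eos hu hr s
  have h1 : HasDerivAt (fun q => u q s) (fderiv ℝ (fun p : ℝ × ℝ => u p.1 p.2) (r, s) (1, 0)) r :=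
    HasFDerivAt.comp_hasDerivAt (l := fun p : ℝ × ℝ => u p.1 p.2) r h
      ((hasDerivAt_id r).prodMk (hasDerivAt_const r s))
  have h2 : HasDerivAt (fun q => u r q) (fderiv ℝ (fun p : ℝ × ℝ => u p.1 p.2) (r, s) (0, 1)) s :=
    HasFDerivAt.comp_hasDerivAt (l := fun p : ℝ × ℝ => u p.1 p.2) s h
      ((hasDerivAt_const s r).prodMk (hasDerivAt_id s))
  have h3 : ((a, b) : ℝ × ℝ) = a • (1, 0) + b • (0, 1) := by simp
  rw [h3, map_add, map_smul, map_smul, ← h1.deriv, ← h2.deriv, pressure, temperature,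
    mul_div_cancel_left₀ _ (by positivity)]
  simp only [smul_eq_mul]
  ring

theorem contDiffOn_fderiv_eos {u : ℝ → ℝ → ℝ} (hu : IsRegularEOS u) :
    ContDiffOn ℝ 1 (fderiv ℝ fun p : ℝ × ℝ => u p.1 p.2) (Ioi 0 ×ˢ univ) :=
  hu.contDiffOn.fderiv_of_isOpen (isOpen_Ioi.prod isOpen_univ) (by norm_num)

theorem contDiffOn_pressure {u : ℝ → ℝ → ℝ} (hu : IsRegularEOS u) :
    ContDiffOn ℝ 1 (fun p : ℝ × ℝ => pressure u p.1 p.2) (Ioi 0 ×ˢ univ) := by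
  have h : ContDiffOn ℝ 1 (fun p : ℝ × ℝ =>
      p.1 ^ 2 * fderiv ℝ (fun p : ℝ × ℝ => u p.1 p.2) p (1, 0)) (Ioi 0 ×ˢ univ) :=
    (contDiff_fst.pow 2).contDiffOn.mul ((contDiffOn_fderiv_eos hu).clm_apply contDiffOn_const)
  refine h.congr fun p hp => ?_
  have hp1 : 0 < p.1 := hp.1
  have := fderiv_eos_apply hu hp1 p.2 1 0
  rw [show fderiv ℝ (fun p : ℝ × ℝ => u p.1 p.2) p (1, 0) = _ from this]
  field_simp
  ring

theorem continuousOn_temperature {u : ℝ → ℝ → ℝ} (hu : IsRegularEOS u) :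
    ContinuousOn (fun p : ℝ × ℝ => temperature u p.1 p.2) (Ioi 0 ×ˢ univ) := by
  have h : ContinuousOn (fun p : ℝ × ℝ =>
      fderiv ℝ (fun p : ℝ × ℝ => u p.1 p.2) p (0, 1)) (Ioi 0 ×ˢ univ) :=
    ((contDiffOn_fderiv_eos hu).clm_apply contDiffOn_const).continuousOn
  refine h.congr fun p hp => ?_
  have := fderiv_eos_apply hu hp.1 p.2 0 1
  rw [mul_zero, zero_add, mul_one] at this
  exact this.symm

namespace IsPerturbation

variable {S : ℝ → FluidState} {Ψ : ℝ → E3 → E3}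

/-- The derivative of ρ u times the Jacobian is arranged so that the equation of state enters only
through u, P/ρ and ρT, the quantities bounded at low density; this gives the dominating constant. At
parameter 0 the term (P/ρ) ρ̇ becomes (P/ρ) Δ(ρ dV) - P div ξ. -/
theorem hasDerivAt_integral_internalDensity (hS : IsPerturbation S Ψ) (hρ : Continuous (S 0).ρ)
    (hDo : IsOpen (S 0).region) (hb : Bornology.IsBounded (S 0).region)
    {u : ℝ → ℝ → ℝ} (hu : IsRegularEOS u) :
    (∀ l ∈ Icc (-1 : ℝ) 1, Integrable (internalDensity u (S l))) ∧
    IntegrableOn (fun x => (u ((S 0).ρ x) ((S 0).s x) + (S 0).P u x / (S 0).ρ x) * lagMass S Ψ x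
      + heatTerm u S Ψ x - (S 0).P u x * divergence (fun y => deriv (fun m => Ψ m y) 0) x)
      (S 0).region ∧
    HasDerivAt (fun l => ∫ y, internalDensity u (S l) y)
      (∫ x in (S 0).region,
        ((u ((S 0).ρ x) ((S 0).s x) + (S 0).P u x / (S 0).ρ x) * lagMass S Ψ x
      + heatTerm u S Ψ x - (S 0).P u x * divergence (fun y => deriv (fun m => Ψ m y) 0) x)) 0 := by
  have hr := hS.continuous_density_pullback hρ
  have hr' := hS.density_deriv_continuous
  have hJ := hS.contDiff_jacobian.continuous
  have hJ' := hS.continuous_deriv_jacobian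
  have hs1 := hS.contDiff_pullback (q := fun l x => (S l).s x) (by norm_num)
    hS.entropy_contDiff
  have hsc := hs1.continuous
  have hs' : Continuous fun p : ℝ × E3 => deriv (fun m => (S m).s (Ψ m p.2)) p.1 :=
    (contDiff_deriv_slice (m := 0) (F := fun m x => (S m).s (Ψ m x)) hs1 (by norm_num)).continuous
  have hsd : ∀ l x, HasDerivAt (fun m => (S m).s (Ψ m x)) (deriv (fun m => (S m).s (Ψ m x)) l) l :=
    fun l x => (hasDerivAt_slice (F := fun m x => (S m).s (Ψ m x))
      (hs1.differentiable (by norm_num) (l, x))).differentiableAt.hasDerivAt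
  have hpos : ∀ l, ∀ x ∈ (S 0).region, 0 < (S l).ρ (Ψ l x) := fun l x hx => (hS.map_region l x).2 hx
  let r : ℝ → E3 → ℝ := fun l x => (S l).ρ (Ψ l x)
  let s : ℝ → E3 → ℝ := fun l x => (S l).s (Ψ l x)
  let r' : ℝ → E3 → ℝ := fun l x => deriv (fun m => (S m).ρ (Ψ m x)) l
  let s' : ℝ → E3 → ℝ := fun l x => deriv (fun m => (S m).s (Ψ m x)) l
  let J : ℝ → E3 → ℝ := fun l x => (fderiv ℝ (Ψ l) x).det
  let J' : ℝ → E3 → ℝ := fun l x => deriv (fun m => (fderiv ℝ (Ψ m) x).det) l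
  let g' : ℝ → E3 → ℝ := fun l x =>
    (u (r l x) (s l x) + pressure u (r l x) (s l x) / r l x) * (r' l x * J l x) +
      r l x * temperature u (r l x) (s l x) * (s' l x * J l x) +
      u (r l x) (s l x) * (r l x * J' l x)
  have hgd : ∀ l, ∀ x ∈ (S 0).region,
      HasDerivAt (fun m => internalDensity u (S m) (Ψ m x) * J m x) (g' l x) l := fun l x hx => by
    have h1 : HasDerivAt (fun m => u (r m x) (s m x))
        (pressure u (r l x) (s l x) / r l x ^ 2 * r' l x + temperature u (r l x) (s l x) * s' l x)
        l := by
      rw [← fderiv_eos_apply hu (hpos l x hx)]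
      exact HasFDerivAt.comp_hasDerivAt (l := fun p : ℝ × ℝ => u p.1 p.2) l
        (hasFDerivAt_eos hu (hpos l x hx) (s l x))
        ((hS.hasDerivAt_density_pullback l x).prodMk (hsd l x))
    refine (((hS.hasDerivAt_density_pullback l x).mul h1).mul
      (hS.hasDerivAt_jacobian l x)).congr_deriv ?_
    have : r l x ≠ 0 := (hpos l x hx).ne'
    simp only [Pi.mul_apply]
    change (r' l x * u (r l x) (s l x) + r l x * _) * J l x + r l x * u (r l x) (s l x) * J' l x = _
    simp only [g']
    field_simp
    ring
  have hslice : ∀ l : ℝ, Continuous fun x : E3 => (l, x) := fun l => by fun_prop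
  have hrs : ∀ l, ContinuousOn (fun x => (r l x, s l x)) (S 0).region := fun l =>
    ((hr.comp (hslice l)).prodMk (hsc.comp (hslice l))).continuousOn
  have hmaps : ∀ l, MapsTo (fun x => (r l x, s l x)) (S 0).region (Ioi 0 ×ˢ univ) := fun l x hx =>
    ⟨hpos l x hx, mem_univ _⟩
  have huc : ∀ l, ContinuousOn (fun x => u (r l x) (s l x)) (S 0).region := fun l =>
    hu.contDiffOn.continuousOn.comp (hrs l) (hmaps l)
  have hPc : ContinuousOn (fun x => pressure u (r 0 x) (s 0 x)) (S 0).region :=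
    (contDiffOn_pressure hu).continuousOn.comp (hrs 0) (hmaps 0)
  have hTc : ContinuousOn (fun x => temperature u (r 0 x) (s 0 x)) (S 0).region :=
    (continuousOn_temperature hu).comp (hrs 0) (hmaps 0)
  obtain ⟨B1, hB1p, hB1⟩ := exists_bound hb hr
  obtain ⟨B2, hB2p, hB2⟩ := exists_bound hb hsc
  obtain ⟨B3, hB3p, hB3⟩ := exists_bound hb (f := fun p => r' p.1 p.2 * J p.1 p.2) (hr'.mul hJ)
  obtain ⟨B4, hB4p, hB4⟩ := exists_bound hb (f := fun p => s' p.1 p.2 * J p.1 p.2) (hs'.mul hJ)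
  obtain ⟨B5, hB5p, hB5⟩ := exists_bound hb (f := fun p => r p.1 p.2 * J' p.1 p.2) (hr.mul hJ')
  obtain ⟨B6, hB6p, hB6⟩ := exists_bound hb (f := fun p => r p.1 p.2 * J p.1 p.2) (hr.mul hJ)
  obtain ⟨C, hC⟩ := hu.bounded (max B1 B2)
  have hC' : ∀ l ∈ Icc (-1 : ℝ) 1, ∀ x ∈ (S 0).region, |u (r l x) (s l x)| ≤ C ∧
      |pressure u (r l x) (s l x) / r l x| ≤ C ∧ |r l x * temperature u (r l x) (s l x)| ≤ C :=
    fun l hl x hx => hC _ _ (hpos l x hx)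
      ((le_abs_self _).trans ((hB1 l hl x hx).trans (le_max_left _ _)))
      ((hB2 l hl x hx).trans (le_max_right _ _))
  have key := hS.hasDerivAt_integral_of_pullback hDo hb (f := fun l => internalDensity u (S l))
    (g' := g') (B := max (C * B6) ((C + C) * B3 + C * B4 + C * B5))
    (fun l y hy => by simp only [internalDensity, hS.density_eq_zero hy, zero_mul]) hgd
    (fun l => (((hr.comp (hslice l)).continuousOn.mul (huc l))).mul
      (hJ.comp (hslice l)).continuousOn)
    (fun l hl x hx => by
      refine le_trans ?_ (le_max_left _ _)
      rw [show internalDensity u (S l) (Ψ l x) * (fderiv ℝ (Ψ l) x).det =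
        u (r l x) (s l x) * (r l x * J l x) by simp only [internalDensity, r, s, J]; ring, abs_mul]
      exact mul_le_mul (hC' l hl x hx).1 (hB6 l hl x hx) (abs_nonneg _)
        ((abs_nonneg _).trans (hC' l hl x hx).1))
    (by
      have c1 : ContinuousOn (r 0) (S 0).region := (hr.comp (hslice 0)).continuousOn
      have c2 : ContinuousOn (r' 0) (S 0).region := (hr'.comp (hslice 0)).continuousOn
      have c3 : ContinuousOn (s' 0) (S 0).region := (hs'.comp (hslice 0)).continuousOn
      have c4 : ContinuousOn (J 0) (S 0).region := (hJ.comp (hslice 0)).continuousOn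
      have c5 : ContinuousOn (J' 0) (S 0).region := (hJ'.comp (hslice 0)).continuousOn
      exact ((((huc 0).add (hPc.div c1 fun x hx => (hpos 0 x hx).ne')).mul (c2.mul c4)).add
        ((c1.mul hTc).mul (c3.mul c4))).add ((huc 0).mul (c1.mul c5)))
    (fun l hl x hx => by
      refine le_trans ?_ (le_max_right _ _)
      obtain ⟨e1, e2, e3⟩ := hC' l hl x hx
      have hC0 : 0 ≤ C := (abs_nonneg _).trans e1
      refine (abs_add_three _ _ _).trans (add_le_add_three ?_ ?_ ?_)
      · rw [abs_mul]
        exact mul_le_mul ((abs_add_le _ _).trans (add_le_add e1 e2)) (hB3 l hl x hx)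
          (abs_nonneg _) (by positivity)
      · rw [abs_mul]
        exact mul_le_mul e3 (hB4 l hl x hx) (abs_nonneg _) hC0
      · rw [abs_mul]
        exact mul_le_mul e1 (hB5 l hl x hx) (abs_nonneg _) hC0)
  have heq : EqOn (g' 0) (fun x => (u ((S 0).ρ x) ((S 0).s x) + (S 0).P u x / (S 0).ρ x) *
      lagMass S Ψ x + heatTerm u S Ψ x -
      (S 0).P u x * divergence (fun y => deriv (fun m => Ψ m y) 0) x) (S 0).region := by
    intro x hx
    have h0 : (S 0).ρ x ≠ 0 := ne_of_gt hx
    simp only [g', r, s, r', s', J, J', hS.jacobian_zero, hS.map_zero, hS.deriv_jacobian_zero,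
      hS.lagMass_eq, heatTerm, lagEntropy, FluidState.P]
    field_simp
    ring
  exact ⟨key.1, key.2.1.congr_fun heq hDo.measurableSet,
    by rw [← setIntegral_congr_fun hDo.measurableSet heq]; exact key.2.2⟩

/-! ### First variation of the field energy -/

theorem contDiff_gradient_potential (hS : IsPerturbation S Ψ) :
    ContDiff ℝ 1 fun p : ℝ × E3 => gradient (S p.1).Φ p.2 :=
  toGradient.contDiff.comp
    (contDiff_fderiv_slice (F := fun l x => (S l).Φ x) hS.potential_contDiff (by norm_num))

theorem deriv_gradient_potential (hS : IsPerturbation S Ψ) (l : ℝ) (x : E3) :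
    deriv (fun m => gradient (S m).Φ x) l = gradient (fun y => deriv (fun m => (S m).Φ y) l) x :=
  (toGradient.hasFDerivAt.comp_hasDerivAt l
    (hasDerivAt_fderiv_slice (F := fun l x => (S l).Φ x) hS.potential_contDiff l x)).deriv

/-- The derivative of |∇Φ|² is 2⟨∇Φ, ∇δΦ⟩, dominated by a multiple of (1 + r)⁻⁴. Green's identity
turns it into -2 δΦ ∇²Φ under the integral, and the Poisson equation at parameter 0 gives -8πG ρ δΦ.
-/
theorem hasDerivAt_integral_field (hS : IsPerturbation S Ψ) (hρ : Continuous (S 0).ρ)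
    (hb : Bornology.IsBounded (S 0).region) {G : ℝ} (hG : 0 < G)
    (hP : ∀ x, Laplacian.laplacian (S 0).Φ x = 4 * Real.pi * G * (S 0).ρ x) :
    (∀ l ∈ Icc (-1 : ℝ) 1,
      Integrable fun x => 1 / (8 * Real.pi * G) * ‖gradient (S l).Φ x‖ ^ 2) ∧
    HasDerivAt (fun l => ∫ x, 1 / (8 * Real.pi * G) * ‖gradient (S l).Φ x‖ ^ 2)
      (-∫ x, (S 0).ρ x * deriv (fun m => (S m).Φ x) 0) 0 := by
  obtain ⟨C, hC⟩ := hS.potential_decay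
  have hC0 : 0 ≤ C := by
    simpa using (norm_nonneg _).trans (hC 0 (by norm_num) 0).1
  have hg := hS.contDiff_gradient_potential
  have hslice : ∀ l : ℝ, Continuous fun x : E3 => (l, x) := fun l => by fun_prop
  have hgc : ∀ l, Continuous fun x => gradient (S l).Φ x := fun l => hg.continuous.comp (hslice l)
  have hg'c : Continuous fun p : ℝ × E3 => deriv (fun m => gradient (S m).Φ p.2) p.1 :=
    (contDiff_deriv_slice (m := 0) (F := fun l x => gradient (S l).Φ x) hg (by norm_num)).continuous
  have hgd : ∀ l x, HasDerivAt (fun m => gradient (S m).Φ x)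
      (deriv (fun m => gradient (S m).Φ x) l) l := fun l x =>
    (hasDerivAt_slice (F := fun l x => gradient (S l).Φ x)
      (hg.differentiable (by norm_num) (l, x))).differentiableAt.hasDerivAt
  have hmul : ∀ x : E3, C / (1 + ‖x‖) ^ 2 * (C / (1 + ‖x‖) ^ 2) = C * C / (1 + ‖x‖) ^ 4 := fun x => by
    have : (0 : ℝ) < 1 + ‖x‖ := by positivity
    field_simp
  have hinner : ∀ l ∈ Icc (-1 : ℝ) 1, ∀ x, |(inner ℝ (gradient (S l).Φ x)
      (deriv (fun m => gradient (S m).Φ x) l) : ℝ)| ≤ C * C / (1 + ‖x‖) ^ 4 := fun l hl x => by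
    rw [← hmul]
    exact (abs_real_inner_le_norm _ _).trans
      (mul_le_mul (hC l hl x).1 (hC l hl x).2.2 (norm_nonneg _) (by positivity))
  have hpi : 0 < 8 * Real.pi * G := by positivity
  set k := 1 / (8 * Real.pi * G) with hk
  have hk0 : 0 ≤ k := by positivity
  have hint : ∀ l ∈ Icc (-1 : ℝ) 1, Integrable fun x => k * ‖gradient (S l).Φ x‖ ^ 2 :=
    fun l hl => Integrable.const_mul (integrable_of_le_one_add_norm_pow_four
      ((hgc l).norm.pow 2).aestronglyMeasurable fun x => by
        rw [← hmul, abs_of_nonneg (sq_nonneg _), pow_two]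
        exact mul_le_mul (hC l hl x).1 (hC l hl x).1 (norm_nonneg _) (by positivity)) k
  refine ⟨hint, ?_⟩
  have h1 := hasDerivAt_integral_of_dominated_loc_of_deriv_le (μ := (volume : Measure E3))
    (F := fun l x => k * ‖gradient (S l).Φ x‖ ^ 2)
    (F' := fun l x => k * (2 * inner ℝ (gradient (S l).Φ x) (deriv (fun m => gradient (S m).Φ x) l)))
    (bound := fun x => k * (2 * (C * C / (1 + ‖x‖) ^ 4)))
    (Icc_mem_nhds (by norm_num) (by norm_num) : Icc (-1 : ℝ) 1 ∈ 𝓝 0)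
    (Eventually.of_forall fun l => (((hgc l).norm.pow 2).const_mul k).aestronglyMeasurable)
    (hint 0 (by norm_num))
    (by
      refine Continuous.aestronglyMeasurable ?_
      exact continuous_const.mul (continuous_const.mul ((hgc 0).inner (hg'c.comp (hslice 0)))))
    (ae_of_all _ fun x l hl => by
      rw [norm_mul, norm_mul, Real.norm_of_nonneg hk0, Real.norm_eq_abs 2, abs_two]
      exact mul_le_mul_of_nonneg_left (mul_le_mul_of_nonneg_left (hinner l hl x) zero_le_two) hk0)
    (((integrable_of_le_one_add_norm_pow_four (C := C * C)
      (by
        refine Continuous.aestronglyMeasurable ?_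
        exact continuous_const.div ((continuous_const.add continuous_norm).pow 4)
          fun x => by positivity)
      (fun x => (abs_of_nonneg (div_nonneg (mul_nonneg hC0 hC0) (by positivity))).le)).const_mul 2).const_mul k)
    (ae_of_all _ fun x l _ => ((hgd l x).norm_sq).const_mul k)
  refine h1.2.congr_deriv ?_
  have hψ : ContDiff ℝ 1 fun x => deriv (fun m => (S m).Φ x) 0 :=
    (contDiff_deriv_slice (m := 1) (F := fun l x => (S l).Φ x) hS.potential_contDiff
      (by norm_num)).comp (contDiff_prodMk_right 0)
  have hin : ∀ x, (inner ℝ (gradient (S 0).Φ x) (deriv (fun m => gradient (S m).Φ x) 0) : ℝ) =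
      fderiv ℝ (fun x => deriv (fun m => (S m).Φ x) 0) x (gradient (S 0).Φ x) := fun x => by
    rw [hS.deriv_gradient_potential, real_inner_comm, inner_gradient_left]
  have hsupp : HasCompactSupport (S 0).ρ :=
    HasCompactSupport.intro hb.isCompact_closure fun x hx =>
      hS.density_eq_zero fun h => hx (subset_closure h)
  have h2 := integral_fderiv_gradient_eq_neg
    (contDiff_slice (F := fun l x => (S l).Φ x) hS.potential_contDiff 0) hψ
    (fun x => (hC 0 (by norm_num) x).1) (fun x => (hC 0 (by norm_num) x).2.1)
    (integrable_of_le_one_add_norm_pow_four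
      ((hψ.continuous_fderiv (by norm_num)).clm_apply (hgc 0)).aestronglyMeasurable
      fun x => by have := hinner 0 (by norm_num) x; rwa [hin] at this)
    (by
      simp only [show (fun x => (S 0).Φ x) = (S 0).Φ from rfl, hP]
      refine Continuous.integrable_of_hasCompactSupport
        (hψ.continuous.mul (continuous_const.mul hρ)) ?_
      exact (hsupp.mul_left (f := fun _ => 4 * Real.pi * G)).mul_left)
  simp only [show (fun x => (S 0).Φ x) = (S 0).Φ from rfl, hP] at h2
  simp_rw [hin]
  rw [integral_const_mul, integral_const_mul, h2]
  have h3 : ∀ x, deriv (fun m => (S m).Φ x) 0 * (4 * Real.pi * G * (S 0).ρ x) =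
      4 * Real.pi * G * ((S 0).ρ x * deriv (fun m => (S m).Φ x) 0) := fun x => by ring
  simp_rw [h3]
  rw [integral_const_mul, hk]
  have := Real.pi_pos.ne'
  field_simp
  ring

end IsPerturbation

/-! ### The generator of rotations -/

/-- The generator of rotations as a linear map. -/
noncomputable def rotLinear : E3 →L[ℝ] E3 :=
  LinearMap.toContinuousLinearMap
    { toFun := rotGen
      map_add' := fun a b => by
        ext i; fin_cases i <;> simp [rotGen]; ring
      map_smul' := fun r a => by
        ext i; fin_cases i <;> simp [rotGen] }

theorem rotLinear_apply (x : E3) : rotLinear x = rotGen x := rfl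

theorem hasFDerivAt_rotGen (x : E3) : HasFDerivAt rotGen rotLinear x :=
  rotLinear.hasFDerivAt

theorem contDiff_rotGen {n : WithTop ℕ∞} : ContDiff ℝ n rotGen :=
  rotLinear.contDiff

/-- Skewness moves the rotation from the displacement to the velocity, where it supplies the term Ω
φ(v) of the inertial force. -/
theorem inner_rotGen (a b : E3) : (inner ℝ (rotGen a) b : ℝ) = - inner ℝ a (rotGen b) := by
  simp [rotGen, PiLp.inner_apply, Fin.sum_univ_three]

theorem divergence_rotGen (x : E3) : divergence rotGen x = 0 := by
  simp only [divergence, (hasFDerivAt_rotGen x).fderiv]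
  change ∑ i : Fin 3, rotGen (EuclideanSpace.single i 1) i = 0
  simp [rotGen, Fin.sum_univ_three]

/-- Velocity in the frame that rotates with angular velocity `Ω`. -/
noncomputable def corotVelocity (Ω : ℝ) (T : FluidState) (x : E3) : E3 := T.v x - Ω • rotGen x

/-- Minus the pressure force per unit mass in a helically symmetric flow. -/
noncomputable def inertialForce (Ω : ℝ) (T : FluidState) (x : E3) : E3 :=
  fderiv ℝ T.v x (corotVelocity Ω T x) + Ω • rotGen (T.v x) + gradient T.Φ x

/-! ### The helical flow in the corotating frame -/

namespace IsHelicalBinary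

variable {G Ω : ℝ} {u : ℝ → ℝ → ℝ} {Q : ℝ → FluidState}

theorem continuous_density (hQ : IsHelicalBinary G Ω u Q) (t : ℝ) : Continuous (Q t).ρ :=
  hQ.density_continuous.comp (by fun_prop : Continuous fun x : E3 => (t, x))

theorem isOpen_region (hQ : IsHelicalBinary G Ω u Q) (t : ℝ) : IsOpen (Q t).region :=
  isOpen_lt continuous_const (hQ.continuous_density t)

theorem density_eq_zero (hQ : IsHelicalBinary G Ω u Q) {t : ℝ} {x : E3} (hx : x ∉ (Q t).region) :
    (Q t).ρ x = 0 :=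
  le_antisymm (not_lt.1 hx) (hQ.density_nonneg t x)

theorem contDiffOn_density (hQ : IsHelicalBinary G Ω u Q) (t : ℝ) :
    ContDiffOn ℝ 1 (Q t).ρ (Q t).region :=
  hQ.density_contDiffOn.comp (contDiff_prodMk_right t).contDiffOn fun _ hx => hx

theorem contDiff_entropy (hQ : IsHelicalBinary G Ω u Q) (t : ℝ) : ContDiff ℝ 1 (Q t).s :=
  contDiff_slice (F := fun t x => (Q t).s x) hQ.entropy_contDiff t

theorem contDiff_velocity (hQ : IsHelicalBinary G Ω u Q) (t : ℝ) : ContDiff ℝ 1 (Q t).v :=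
  contDiff_slice (F := fun t x => (Q t).v x) hQ.velocity_contDiff t

theorem contDiff_corotVelocity (hQ : IsHelicalBinary G Ω u Q) (t : ℝ) :
    ContDiff ℝ 1 (corotVelocity Ω (Q t)) :=
  (hQ.contDiff_velocity t).sub (contDiff_rotGen.const_smul Ω)

theorem continuous_inertialForce (hQ : IsHelicalBinary G Ω u Q) (t : ℝ) :
    Continuous (inertialForce Ω (Q t)) :=
  ((((hQ.contDiff_velocity t).continuous_fderiv (by norm_num)).clm_apply
    (hQ.contDiff_corotVelocity t).continuous).add
    ((contDiff_rotGen (n := 0)).continuous.comp (hQ.contDiff_velocity t).continuous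
      |>.const_smul Ω)).add (contDiff_gradient (hQ.potential_contDiff t)).continuous

/-- The mass current is stationary in the corotating frame. -/
theorem corotating_continuity (hQ : IsHelicalBinary G Ω u Q) (t : ℝ) {x : E3}
    (hx : x ∈ (Q t).region) :
    fderiv ℝ (Q t).ρ x (corotVelocity Ω (Q t) x) +
      (Q t).ρ x * divergence (corotVelocity Ω (Q t)) x = 0 := by
  have hρ : DifferentiableAt ℝ (Q t).ρ x :=
    ((hQ.contDiffOn_density t).contDiffAt ((hQ.isOpen_region t).mem_nhds hx)).differentiableAt
      (by norm_num)
  have hv : DifferentiableAt ℝ (Q t).v x := (hQ.contDiff_velocity t).differentiable (by norm_num) x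
  have h1 := hQ.continuity t x hx
  have h2 := hQ.helical_density t x hx
  rw [divergence_smul hρ hv] at h1
  have h3 : divergence (corotVelocity Ω (Q t)) x = divergence (Q t).v x := by
    have h4 : HasFDerivAt (corotVelocity Ω (Q t)) (fderiv ℝ (Q t).v x - Ω • rotLinear) x :=
      hv.hasFDerivAt.sub ((hasFDerivAt_rotGen x).const_smul Ω)
    have h5 := divergence_rotGen x
    simp only [divergence, (hasFDerivAt_rotGen x).fderiv] at h5
    simp only [divergence, h4.fderiv, sub_apply, smul_apply, PiLp.sub_apply, PiLp.smul_apply,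
      Finset.sum_sub_distrib, smul_eq_mul, ← Finset.mul_sum, h5]
    ring
  rw [h3, corotVelocity, map_sub, map_smul, smul_eq_mul]
  linarith

theorem pressure_eq_zero (hQ : IsHelicalBinary G Ω u Q) {t : ℝ} {x : E3}
    (hx : x ∉ (Q t).region) : (Q t).P u x = 0 := by
  simp [FluidState.P, pressure, hQ.density_eq_zero hx]

theorem contDiffOn_pressure_field (hu : IsRegularEOS u) (hQ : IsHelicalBinary G Ω u Q) (t : ℝ) :
    ContDiffOn ℝ 1 ((Q t).P u) (Q t).region :=
  (contDiffOn_pressure hu).comp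
    ((hQ.contDiffOn_density t).prodMk (hQ.contDiff_entropy t).contDiffOn)
    fun _ hx => mk_mem_prod (mem_Ioi.2 hx) (mem_univ _)

/-- Helical symmetry expresses ∂_t v as -Ω(∇_φ v - φ(v)). Euler's equation then becomes ∇P = -ρF,
free of time derivatives. -/
theorem fderiv_pressure (hQ : IsHelicalBinary G Ω u Q) (t : ℝ) {x : E3}
    (hx : x ∈ (Q t).region) (a : E3) :
    fderiv ℝ ((Q t).P u) x a = -((Q t).ρ x * inner ℝ (inertialForce Ω (Q t) x) a) := by
  have h1 := hQ.euler t x hx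
  have h2 := hQ.helical_velocity t x hx
  have h3 : VectorField.lieBracket ℝ rotGen (Q t).v x =
      fderiv ℝ (Q t).v x (rotGen x) - rotGen ((Q t).v x) := by
    rw [VectorField.lieBracket, (hasFDerivAt_rotGen x).fderiv]
    rfl
  rw [h3] at h2
  have hρ : (Q t).ρ x ≠ 0 := ne_of_gt hx
  have h4 : (1 / (Q t).ρ x) • gradient ((Q t).P u) x = - inertialForce Ω (Q t) x := by
    have e1 : (1 / (Q t).ρ x) • gradient ((Q t).P u) x = - gradient (Q t).Φ x -
        (deriv (fun τ => (Q τ).v x) t + fderiv ℝ (Q t).v x ((Q t).v x)) := by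
      rw [h1]; abel
    have e2 : deriv (fun τ => (Q τ).v x) t =
        -(Ω • (fderiv ℝ (Q t).v x (rotGen x) - rotGen ((Q t).v x))) := eq_neg_of_add_eq_zero_left h2
    rw [e1, e2, inertialForce, corotVelocity, map_sub, map_smul, smul_sub]
    abel
  have h5 : gradient ((Q t).P u) x = -((Q t).ρ x • inertialForce Ω (Q t) x) := by
    rw [← smul_neg, ← h4, smul_smul, mul_one_div_cancel hρ, one_smul]
  rw [← inner_gradient_left, h5, inner_neg_left, real_inner_smul_left]

/-- Boundedness of P/ρ gives |P| ≤ Cρ, so P tends to zero at the surface together with ρ. -/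
theorem continuous_pressure (hu : IsRegularEOS u) (hQ : IsHelicalBinary G Ω u Q) (t : ℝ) :
    Continuous ((Q t).P u) := by
  obtain ⟨B1, -, hB1⟩ := Continuous.exists_bound_of_isBounded (hQ.region_bounded t)
    (hQ.continuous_density t)
  obtain ⟨B2, -, hB2⟩ := Continuous.exists_bound_of_isBounded (hQ.region_bounded t)
    (hQ.contDiff_entropy t).continuous
  obtain ⟨C, hC⟩ := hu.bounded (max B1 B2)
  have hle : ∀ x, |(Q t).P u x| ≤ C * (Q t).ρ x := fun x => by
    by_cases hx : x ∈ (Q t).region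
    · have hρ : 0 < (Q t).ρ x := hx
      have := (hC _ _ hρ ((le_abs_self _).trans ((hB1 x hx).trans (le_max_left _ _)))
        ((hB2 x hx).trans (le_max_right _ _))).2.1
      rwa [abs_div, abs_of_pos hρ, div_le_iff₀ hρ] at this
    · rw [hQ.pressure_eq_zero hx, hQ.density_eq_zero hx]
      simp
  rw [continuous_iff_continuousAt]
  intro x
  by_cases hx : x ∈ (Q t).region
  · exact (hQ.contDiffOn_pressure_field hu t).continuousOn.continuousAt
      ((hQ.isOpen_region t).mem_nhds hx)
  · rw [ContinuousAt, hQ.pressure_eq_zero hx]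
    refine squeeze_zero_norm hle ?_
    have := ((hQ.continuous_density t).const_mul C).tendsto x
    rwa [hQ.density_eq_zero hx, mul_zero] at this

/-- The interior gradient -ρF extends continuously by zero: F is continuous on all of space and ρ
vanishes outside the fluid. So the pressure is C¹ everywhere. -/
theorem hasFDerivAt_pressure (hu : IsRegularEOS u) (hQ : IsHelicalBinary G Ω u Q) (t : ℝ) (x : E3) :
    HasFDerivAt ((Q t).P u) (-((Q t).ρ x • innerSL ℝ (inertialForce Ω (Q t) x))) x := by
  refine hasFDerivAt_of_eq_zero_compl (D := (Q t).region)
    (f' := fun x => -((Q t).ρ x • innerSL ℝ (inertialForce Ω (Q t) x)))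
    (hQ.continuous_pressure hu t) ?_ (fun x hx => hQ.pressure_eq_zero hx)
    (fun x hx => by simp [hQ.density_eq_zero hx]) (fun x hx => ?_) x
  · exact ((hQ.continuous_density t).smul
      ((innerSL ℝ).continuous.comp (hQ.continuous_inertialForce t))).neg
  · have h := (((hQ.contDiffOn_pressure_field hu t).contDiffAt
      ((hQ.isOpen_region t).mem_nhds hx)).differentiableAt (by norm_num)).hasFDerivAt
    have h2 : fderiv ℝ ((Q t).P u) x = -((Q t).ρ x • innerSL ℝ (inertialForce Ω (Q t) x)) := by
      ext a
      rw [hQ.fderiv_pressure t hx]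
      simp
    rwa [h2] at h

/-- The work of the pressure against a displacement. -/
theorem integral_pressure_mul_divergence (hu : IsRegularEOS u) (hQ : IsHelicalBinary G Ω u Q)
    (t : ℝ) {ξ : E3 → E3} (hξ : ContDiff ℝ 1 ξ) :
    ∫ x in (Q t).region, ((Q t).P u x * divergence ξ x -
      (Q t).ρ x * inner ℝ (inertialForce Ω (Q t) x) (ξ x)) = 0 := by
  have hP : ContDiff ℝ 1 ((Q t).P u) := by
    rw [contDiff_one_iff_fderiv]
    refine ⟨fun x => (hQ.hasFDerivAt_pressure hu t x).differentiableAt, ?_⟩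
    rw [funext fun x => (hQ.hasFDerivAt_pressure hu t x).fderiv]
    exact ((hQ.continuous_density t).smul
      ((innerSL ℝ).continuous.comp (hQ.continuous_inertialForce t))).neg
  have hc : HasCompactSupport ((Q t).P u) :=
    HasCompactSupport.intro (hQ.region_bounded t).isCompact_closure fun x hx =>
      hQ.pressure_eq_zero fun h => hx (subset_closure h)
  have h := integral_divergence_eq_zero_of_hasCompactSupport (F := fun x => (Q t).P u x • ξ x)
    (hP.smul hξ) hc.smul_right
  rw [setIntegral_eq_integral_of_forall_compl_eq_zero
    (fun x hx => by simp [hQ.pressure_eq_zero hx, hQ.density_eq_zero hx]), ← h]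
  refine integral_congr_ae (ae_of_all _ fun x => ?_)
  simp only
  rw [divergence_smul (hP.differentiable (by norm_num) x) (hξ.differentiable (by norm_num) x),
    (hQ.hasFDerivAt_pressure hu t x).fderiv]
  simp
  ring

theorem integral_density_mul_fderiv (hQ : IsHelicalBinary G Ω u Q) (t : ℝ) {f : E3 → ℝ}
    (hf : ContDiffOn ℝ 1 f (Q t).region) {M : ℝ} (hM : ∀ x ∈ (Q t).region, ‖fderiv ℝ f x‖ ≤ M) :
    ∫ x in (Q t).region, (Q t).ρ x * fderiv ℝ f x (corotVelocity Ω (Q t) x) = 0 :=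
  integral_mul_fderiv_eq_zero (hQ.continuous_density t) rfl (hQ.region_bounded t)
    (hQ.density_nonneg t) (hQ.contDiffOn_density t) (hQ.contDiff_corotVelocity t)
    (fun _ hx => hQ.corotating_continuity t hx) hf hM

/-- The bracket is the derivative of ⟨v, ξ⟩ along w, so this is the flux lemma for a function that
is C¹ on all of space. -/
theorem integral_density_mul_inner (hQ : IsHelicalBinary G Ω u Q) (t : ℝ) {ξ : E3 → E3}
    (hξ : ContDiff ℝ 1 ξ) :
    ∫ x in (Q t).region, (Q t).ρ x *
      (inner ℝ (fderiv ℝ (Q t).v x (corotVelocity Ω (Q t) x)) (ξ x) +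
        inner ℝ ((Q t).v x) (fderiv ℝ ξ x (corotVelocity Ω (Q t) x))) = 0 := by
  have hf : ContDiff ℝ 1 fun x => (inner ℝ ((Q t).v x) (ξ x) : ℝ) :=
    (hQ.contDiff_velocity t).inner ℝ hξ
  obtain ⟨M, -, hM⟩ := Continuous.exists_bound_of_isBounded (hQ.region_bounded t)
    (hf.continuous_fderiv (by norm_num))
  rw [← hQ.integral_density_mul_fderiv t hf.contDiffOn hM]
  congr 1 with x
  rw [fderiv_inner_apply ℝ ((hQ.contDiff_velocity t).differentiable (by norm_num) x)
    (hξ.differentiable (by norm_num) x), add_comm]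

end IsHelicalBinary

/-! ### Pointwise Lagrangian derivatives -/

namespace IsPerturbation

variable {S : ℝ → FluidState} {Ψ : ℝ → E3 → E3}

theorem contDiff_displacement (hS : IsPerturbation S Ψ) :
    ContDiff ℝ 2 fun y => deriv (fun m => Ψ m y) 0 :=
  (contDiff_deriv_slice (m := 2) hS.map_contDiff (by norm_num)).comp (contDiff_prodMk_right 0)

theorem hasDerivAt_map (hS : IsPerturbation S Ψ) (x : E3) :
    HasDerivAt (fun m => Ψ m x) (deriv (fun m => Ψ m x) 0) 0 :=
  (hasDerivAt_slice (hS.map_contDiff.differentiable (by norm_num) (0, x))).differentiableAt.hasDerivAt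

theorem contDiff_velocity_pullback (hS : IsPerturbation S Ψ) :
    ContDiff ℝ 2 fun p : ℝ × E3 => (S p.1).v (Ψ p.1 p.2) :=
  hS.contDiff_pullback (q := fun l x => (S l).v x) (by norm_num) hS.velocity_contDiff

theorem hasDerivAt_velocity_pullback (hS : IsPerturbation S Ψ) (x : E3) :
    HasDerivAt (fun m => (S m).v (Ψ m x)) (deriv (fun m => (S m).v (Ψ m x)) 0) 0 :=
  (hasDerivAt_slice (F := fun m x => (S m).v (Ψ m x))
    (hS.contDiff_velocity_pullback.differentiable (by norm_num)
      (0, x))).differentiableAt.hasDerivAt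

theorem continuous_deriv_velocity_pullback (hS : IsPerturbation S Ψ) :
    Continuous fun x => deriv (fun m => (S m).v (Ψ m x)) 0 :=
  (contDiff_deriv_slice (m := 1) (F := fun m x => (S m).v (Ψ m x)) hS.contDiff_velocity_pullback
    (by norm_num)).continuous.comp (by fun_prop : Continuous fun x : E3 => ((0 : ℝ), x))

theorem lagVelocity_eq (hS : IsPerturbation S Ψ) (x w : E3) :
    lagVelocity S Ψ x w = inner ℝ (deriv (fun m => (S m).v (Ψ m x)) 0) w +
      inner ℝ ((S 0).v x) (fderiv ℝ (fun y => deriv (fun m => Ψ m y) 0) x w) := by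
  have h1 : HasDerivAt (fun m => fderiv ℝ (Ψ m) x w)
      (fderiv ℝ (fun y => deriv (fun m => Ψ m y) 0) x w) 0 := by
    have := (hasDerivAt_fderiv_slice (hS.map_contDiff.of_le (by norm_num)) 0 x).clm_apply
      (hasDerivAt_const (0 : ℝ) w)
    simpa using this
  have h2 := ((hS.hasDerivAt_velocity_pullback x).inner ℝ h1).deriv
  rw [hS.map_zero, hS.fderiv_map_zero] at h2
  rw [lagVelocity, h2, add_comm]
  rfl

theorem deriv_kinetic (hS : IsPerturbation S Ψ) (x : E3) :
    deriv (fun m => 1 / 2 * ‖(S m).v (Ψ m x)‖ ^ 2) 0 =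
      inner ℝ ((S 0).v x) (deriv (fun m => (S m).v (Ψ m x)) 0) := by
  rw [((hS.hasDerivAt_velocity_pullback x).norm_sq.const_mul (1 / 2)).deriv, hS.map_zero]
  ring

theorem deriv_angular (hS : IsPerturbation S Ψ) (x : E3) :
    deriv (fun m => (inner ℝ ((S m).v (Ψ m x)) (rotGen (Ψ m x)) : ℝ)) 0 =
      inner ℝ (deriv (fun m => (S m).v (Ψ m x)) 0) (rotGen x) +
        inner ℝ ((S 0).v x) (rotGen (deriv (fun m => Ψ m x) 0)) := by
  have h1 : HasDerivAt (fun m => rotGen (Ψ m x)) (rotLinear (deriv (fun m => Ψ m x) 0)) 0 :=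
    HasFDerivAt.comp_hasDerivAt (l := rotGen) 0 (hasFDerivAt_rotGen (Ψ 0 x)) (hS.hasDerivAt_map x)
  rw [((hS.hasDerivAt_velocity_pullback x).inner ℝ h1).deriv, hS.map_zero, add_comm, rotLinear_apply]

/-- The Lagrangian change is the Eulerian change plus advection along the displacement. The Eulerian
part cancels against the field energy. -/
theorem deriv_potential (hS : IsPerturbation S Ψ) (x : E3) :
    deriv (fun m => (S m).Φ (Ψ m x)) 0 = deriv (fun m => (S m).Φ x) 0 +
      inner ℝ (gradient (S 0).Φ x) (deriv (fun m => Ψ m x) 0) := by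
  have hd := hS.potential_contDiff.differentiable (by norm_num) ((0 : ℝ), x)
  have h1 : HasDerivAt (fun m => (m, Ψ m x)) ((1 : ℝ), deriv (fun m => Ψ m x) 0) 0 :=
    (hasDerivAt_id 0).prodMk (hS.hasDerivAt_map x)
  have h2 := HasFDerivAt.comp_hasDerivAt_of_eq (0 : ℝ) hd.hasFDerivAt h1
    (by rw [hS.map_zero])
  have h3 : HasDerivAt (fun m => (S m).Φ (Ψ m x)) _ 0 := h2
  rw [h3.deriv, (hasDerivAt_slice (F := fun l x => (S l).Φ x) hd).deriv, inner_gradient_left,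
    (hasFDerivAt_slice (F := fun l x => (S l).Φ x) hd).fderiv]
  simp only [ContinuousLinearMap.comp_apply, ContinuousLinearMap.inr_apply]
  rw [← map_add]
  simp

/-! ### The velocity one-form -/

/-- The pullback of the velocity covector field. -/
noncomputable def _root_.NewtonianBinary.pullbackVelocity (S : ℝ → FluidState) (Ψ : ℝ → E3 → E3)
    (l : ℝ) (x : E3) : E3 →L[ℝ] ℝ :=
  (innerSL ℝ ((S l).v (Ψ l x))).comp (fderiv ℝ (Ψ l) x)

theorem contDiff_pullbackVelocity (hS : IsPerturbation S Ψ) :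
    ContDiff ℝ 2 fun p : ℝ × E3 => pullbackVelocity S Ψ p.1 p.2 :=
  ((innerSL ℝ).contDiff.comp hS.contDiff_velocity_pullback).clm_comp
    (contDiff_fderiv_slice hS.map_contDiff (by norm_num))

theorem deriv_pullbackVelocity_apply (hS : IsPerturbation S Ψ) (x w : E3) :
    deriv (fun m => pullbackVelocity S Ψ m x) 0 w = lagVelocity S Ψ x w := by
  have h := (hasDerivAt_slice (F := pullbackVelocity S Ψ)
    (hS.contDiff_pullbackVelocity.differentiable (by norm_num)
      (0, x))).differentiableAt.hasDerivAt.clm_apply (hasDerivAt_const (0 : ℝ) w)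
  have h2 : HasDerivAt (fun m => pullbackVelocity S Ψ m x w)
      (deriv (fun m => pullbackVelocity S Ψ m x) 0 w) 0 := by simpa using h
  exact h2.deriv.symm

theorem contDiff_deriv_pullbackVelocity (hS : IsPerturbation S Ψ) :
    ContDiff ℝ 1 fun x => deriv (fun m => pullbackVelocity S Ψ m x) 0 :=
  ContDiff.comp (g := fun p : ℝ × E3 => deriv (fun m => pullbackVelocity S Ψ m p.2) p.1)
    (f := fun x : E3 => ((0 : ℝ), x))
    (contDiff_deriv_slice (m := 1) hS.contDiff_pullbackVelocity (by norm_num))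
    (contDiff_prodMk_right 0)

/-- The exterior derivative commutes with pullback. -/
theorem vorticity_pullback (hS : IsPerturbation S Ψ) (l : ℝ) (x a b : E3) :
    vorticity (S l).v (Ψ l x) (fderiv ℝ (Ψ l) x a) (fderiv ℝ (Ψ l) x b) =
      fderiv ℝ (pullbackVelocity S Ψ l) x b a - fderiv ℝ (pullbackVelocity S Ψ l) x a b := by
  have hΨ := contDiff_slice hS.map_contDiff l
  have hv : Differentiable ℝ (S l).v :=
    (contDiff_slice (F := fun l x => (S l).v x) hS.velocity_contDiff l).differentiable (by norm_num)
  have h1 : HasFDerivAt (fun y => (S l).v (Ψ l y))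
      ((fderiv ℝ (S l).v (Ψ l x)).comp (fderiv ℝ (Ψ l) x)) x :=
    (hv (Ψ l x)).hasFDerivAt.comp x (hS.hasFDerivAt_map l x)
  have h2 : DifferentiableAt ℝ (fderiv ℝ (Ψ l)) x :=
    (hΨ.fderiv_right (m := 1) (by norm_num)).differentiable (by norm_num) x
  have hsym := hΨ.contDiffAt.isSymmSndFDerivAt (x := x) (by simp; norm_num) a b
  have h3 : ∀ c d, fderiv ℝ (pullbackVelocity S Ψ l) x c d =
      inner ℝ (fderiv ℝ (S l).v (Ψ l x) (fderiv ℝ (Ψ l) x c)) (fderiv ℝ (Ψ l) x d) +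
        inner ℝ ((S l).v (Ψ l x)) (fderiv ℝ (fderiv ℝ (Ψ l)) x c d) := fun c d => by
    have h4 := ((innerSL ℝ).hasFDerivAt.comp x h1).clm_comp h2.hasFDerivAt
    have h5 : HasFDerivAt (pullbackVelocity S Ψ l) _ x := h4
    rw [h5.fderiv]
    simp [add_comm]
    rfl
  -- The terms with second derivatives of `Ψ l` are symmetric in the two vectors and drop out of the
  -- antisymmetrization.
  rw [h3, h3, vorticity, hsym]
  ring

/-- Parameter and space derivatives commute, so a vanishing Lagrangian change of vorticity says that
the one-form Δv_i is closed. -/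
theorem fderiv_deriv_pullbackVelocity (hS : IsPerturbation S Ψ) (x a b : E3) :
    lagVorticity S Ψ x a b =
      fderiv ℝ (fun y => deriv (fun m => pullbackVelocity S Ψ m y) 0) x b a -
        fderiv ℝ (fun y => deriv (fun m => pullbackVelocity S Ψ m y) 0) x a b := by
  have h := hasDerivAt_fderiv_slice (F := pullbackVelocity S Ψ) hS.contDiff_pullbackVelocity 0 x
  have h1 : ∀ c d, HasDerivAt (fun m => fderiv ℝ (pullbackVelocity S Ψ m) x c d)
      (fderiv ℝ (fun y => deriv (fun m => pullbackVelocity S Ψ m y) 0) x c d) 0 := fun c d => by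
    have := (h.clm_apply (hasDerivAt_const (0 : ℝ) c)).clm_apply (hasDerivAt_const (0 : ℝ) d)
    simpa using this
  simp only [lagVorticity, hS.vorticity_pullback]
  exact ((h1 b a).sub (h1 a b)).deriv

/-- A vorticity-conserving perturbation of simply connected stars does not contribute to the first
law. -/
theorem integral_circulationTerm_eq_zero {G Ω : ℝ} {u : ℝ → ℝ → ℝ} {Q : ℝ → FluidState}
    (hQ : IsHelicalBinary G Ω u Q) {t : ℝ} (hS : IsPerturbation S Ψ) (hS₀ : S 0 = Q t)
    (hsc : ∀ x ∈ (S 0).region, IsSimplyConnected (connectedComponentIn (S 0).region x))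
    (hω : ∀ x ∈ (S 0).region, ∀ a b, lagVorticity S Ψ x a b = 0) :
    ∫ x in (S 0).region, circulationTerm Ω S Ψ x = 0 := by
  have hDo : IsOpen (S 0).region := hS₀ ▸ hQ.isOpen_region t
  have hb : Bornology.IsBounded (S 0).region := hS₀ ▸ hQ.region_bounded t
  have hα := hS.contDiff_deriv_pullbackVelocity
  obtain ⟨f, hf⟩ := exists_primitive_of_components hDo hsc
    (hα.differentiable (by norm_num)).differentiableOn
    fun x hx a b => by
      have := hS.fderiv_deriv_pullbackVelocity x b a
      rw [hω x hx] at this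
      linarith
  obtain ⟨M, -, hM⟩ := Continuous.exists_bound_of_isBounded hb hα.continuous
  have hfd : ∀ x ∈ (S 0).region, fderiv ℝ f x = deriv (fun m => pullbackVelocity S Ψ m x) 0 :=
    fun x hx => (hf x hx).fderiv
  -- The primitive is C¹ because its differential is the continuous one-form Δv_i, whose bound on
  -- the bounded region also bounds the gradient.
  have hfC : ContDiffOn ℝ 1 f (S 0).region := by
    rw [show (1 : WithTop ℕ∞) = 0 + 1 by norm_num, contDiffOn_succ_iff_fderiv_of_isOpen hDo]
    exact ⟨fun x hx => (hf x hx).differentiableAt.differentiableWithinAt, by simp,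
      contDiffOn_zero.2 (hα.continuous.continuousOn.congr hfd)⟩
  have h := hQ.integral_density_mul_fderiv t (f := f) (hS₀ ▸ hfC) (M := M)
    (fun x hx => by
      rw [← hS₀] at hx
      rw [hfd x hx]
      exact hM x hx)
  refine Eq.trans ?_ h
  rw [← hS₀]
  refine setIntegral_congr_fun hDo.measurableSet fun x hx => ?_
  simp only [hfd x hx, hS.deriv_pullbackVelocity_apply]
  rfl

theorem heatTerm_integrableOn (hS : IsPerturbation S Ψ) (hρ : Continuous (S 0).ρ)
    (hDo : IsOpen (S 0).region) (hb : Bornology.IsBounded (S 0).region)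
    {u : ℝ → ℝ → ℝ} (hu : IsRegularEOS u) : IntegrableOn (heatTerm u S Ψ) (S 0).region := by
  have hs : Continuous (S 0).s :=
    (contDiff_slice (F := fun l x => (S l).s x) hS.entropy_contDiff 0).continuous
  have hs' : Continuous (lagEntropy S Ψ) :=
    (contDiff_deriv_slice (m := 0) (F := fun m x => (S m).s (Ψ m x))
      (hS.contDiff_pullback (q := fun l x => (S l).s x) (by norm_num) hS.entropy_contDiff)
      (by norm_num)).continuous.comp (by fun_prop : Continuous fun x : E3 => ((0 : ℝ), x))
  obtain ⟨B1, -, hB1⟩ := Continuous.exists_bound_of_isBounded hb hρ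
  obtain ⟨B2, -, hB2⟩ := Continuous.exists_bound_of_isBounded hb hs
  obtain ⟨B3, hB3p, hB3⟩ := Continuous.exists_bound_of_isBounded hb hs'
  obtain ⟨C, hC⟩ := hu.bounded (max B1 B2)
  refine integrableOn_of_continuousOn_of_bounded hDo hb (C := C * B3) ?_ fun x hx => ?_
  · refine (hρ.continuousOn.mul ?_).mul hs'.continuousOn
    exact (continuousOn_temperature hu).comp (hρ.prodMk hs).continuousOn
      fun x hx => mk_mem_prod (mem_Ioi.2 hx) (mem_univ _)
  · rw [heatTerm, abs_mul]
    have h := (hC _ _ (show 0 < (S 0).ρ x from hx)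
      ((le_abs_self _).trans ((hB1 x hx).trans (le_max_left _ _)))
      ((hB2 x hx).trans (le_max_right _ _))).2.2
    exact mul_le_mul h (hB3 x hx) (abs_nonneg _) ((abs_nonneg _).trans h)

end IsPerturbation

/-! ### Assembly of the first law -/

theorem setIntegral_region_eq {T : FluidState} (hT : ∀ x, 0 ≤ T.ρ x) {f : E3 → ℝ}
    (hf : ∀ x, T.ρ x = 0 → f x = 0) : ∫ x in T.region, f x = ∫ x, f x :=
  setIntegral_eq_integral_of_forall_compl_eq_zero fun x hx =>
    hf x (le_antisymm (not_lt.1 hx) (hT x))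

theorem integrable_of_integrableOn_region {T : FluidState} (hT : ∀ x, 0 ≤ T.ρ x) {f : E3 → ℝ}
    (hf : ∀ x, T.ρ x = 0 → f x = 0) (h : IntegrableOn f T.region) : Integrable f :=
  (integrableOn_iff_integrable_of_support_subset (Function.support_subset_iff'.2 fun x hx =>
    hf x (le_antisymm (not_lt.1 hx) (hT x)))).1 h

/-- A point outside the fluid is carried outside the fluid for every parameter. Thus the values of u
and P/ρ at zero density do not enter the integral of `massTerm`. -/
theorem IsPerturbation.lagMass_eq_zero {S : ℝ → FluidState} {Ψ : ℝ → E3 → E3}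
    (hS : IsPerturbation S Ψ) {x : E3} (hx : (S 0).ρ x = 0) : lagMass S Ψ x = 0 := by
  have hx' : x ∉ (S 0).region := fun h => (ne_of_gt h) hx
  have : ∀ l, (S l).ρ (Ψ l x) = 0 := fun l => hS.density_eq_zero ((hS.map_region l x).not.2 hx')
  simp [lagMass, this]

/-- The two sides of the first law agree pointwise only up to `z` and `z'`, whose integrals vanish.
In the application these are the pressure-work and flux integrands. -/
theorem integral_balance {X : Type*} [MeasurableSpace X] {μ : Measure X}
    {a b c d j h m e z z' : X → ℝ} {k : ℝ} (ha : Integrable a μ) (hb : Integrable b μ)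
    (hc : Integrable c μ) (hd : Integrable d μ) (hj : Integrable j μ) (hh : Integrable h μ)
    (hm : Integrable m μ) (he : Integrable e μ) (hz : Integrable z μ) (hz' : Integrable z' μ)
    (hz0 : ∫ x, z x ∂μ = 0) (hz0' : ∫ x, z' x ∂μ = 0)
    (heq : ∀ᵐ x ∂μ, a x + (b x - c x) + d x = k * j x + h x + m x + e x - z x - z' x) :
    ∫ x, a x ∂μ + (∫ x, b x ∂μ + -∫ x, c x ∂μ) + ∫ x, d x ∂μ =
      k * ∫ x, j x ∂μ + ∫ x, h x ∂μ + ∫ x, m x ∂μ + ∫ x, e x ∂μ := by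
  have H := integral_congr_ae heq
  have hkj := hj.const_mul k
  rw [integral_add (f := fun x => a x + (b x - c x)) (ha.add (hb.sub hc)) hd,
    integral_add (g := fun x => b x - c x) ha (hb.sub hc), integral_sub hb hc,
    integral_sub (f := fun x => k * j x + h x + m x + e x - z x)
      ((((hkj.add hh).add hm).add he).sub hz) hz',
    integral_sub (f := fun x => k * j x + h x + m x + e x) (((hkj.add hh).add hm).add he) hz,
    integral_add (f := fun x => k * j x + h x + m x) ((hkj.add hh).add hm) he,
    integral_add (f := fun x => k * j x + h x) (hkj.add hh) hm, integral_add hkj hh,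
    integral_const_mul, hz0, hz0'] at H
  linarith

end NewtonianBinary

open NewtonianBinary in
theorem mainTheorem11 (G Ω : ℝ) (hG : 0 < G)
    (u : ℝ → ℝ → ℝ) (hu : NewtonianBinary.IsRegularEOS u)
    (Q : ℝ → NewtonianBinary.FluidState) (hQ : NewtonianBinary.IsHelicalBinary G Ω u Q)
    (t₀ : ℝ) (S : ℝ → NewtonianBinary.FluidState)
    (Ψ : ℝ → NewtonianBinary.E3 → NewtonianBinary.E3)
    (hS : NewtonianBinary.IsPerturbation S Ψ) (hS₀ : S 0 = Q t₀) :
    (∀ᶠ l in 𝓝 (0 : ℝ),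
      Integrable (NewtonianBinary.kineticDensity (S l)) ∧
      Integrable (NewtonianBinary.gravDensity G (S l)) ∧
      Integrable (NewtonianBinary.internalDensity u (S l)) ∧
      Integrable (NewtonianBinary.angularDensity (S l))) ∧
    Integrable (NewtonianBinary.heatTerm u S Ψ) ∧
    Integrable (NewtonianBinary.massTerm Ω u S Ψ) ∧
    Integrable (NewtonianBinary.circulationTerm Ω S Ψ) ∧
    DifferentiableAt ℝ (fun l => NewtonianBinary.angularMomentum (S l)) 0 ∧
    HasDerivAt (fun l => NewtonianBinary.energy G u (S l))
      (Ω * deriv (fun l => NewtonianBinary.angularMomentum (S l)) 0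
        + (∫ x, NewtonianBinary.heatTerm u S Ψ x)
        + (∫ x, NewtonianBinary.massTerm Ω u S Ψ x)
        + ∫ x, NewtonianBinary.circulationTerm Ω S Ψ x) 0 ∧
    ((∀ x ∈ (S 0).region, IsSimplyConnected (connectedComponentIn (S 0).region x)) →
      (∀ x ∈ (S 0).region, NewtonianBinary.lagEntropy S Ψ x = 0) →
      (∀ x ∈ (S 0).region, NewtonianBinary.lagMass S Ψ x = 0) →
      (∀ x ∈ (S 0).region, ∀ a b, NewtonianBinary.lagVorticity S Ψ x a b = 0) →
      HasDerivAt (fun l => NewtonianBinary.energy G u (S l))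
        (Ω * deriv (fun l => NewtonianBinary.angularMomentum (S l)) 0) 0) := by
  have hρ : Continuous (S 0).ρ := hS₀ ▸ hQ.continuous_density t₀
  have hDo : IsOpen (S 0).region := hS₀ ▸ hQ.isOpen_region t₀
  have hb : Bornology.IsBounded (S 0).region := hS₀ ▸ hQ.region_bounded t₀
  have hρ0 := hS.density_nonneg 0
  have hI : Icc (-1 : ℝ) 1 ∈ 𝓝 (0 : ℝ) := Icc_mem_nhds (by norm_num) (by norm_num)
  obtain ⟨kin1, kin2, kin3⟩ := hS.hasDerivAt_integral_density_mul hρ hDo hb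
    (q := fun l x => 1 / 2 * ‖(S l).v x‖ ^ 2)
    (contDiff_const.mul ((hS.velocity_contDiff.of_le (by norm_num)).norm_sq ℝ))
  obtain ⟨ang1, ang2, ang3⟩ := hS.hasDerivAt_integral_density_mul hρ hDo hb
    (q := fun l x => inner ℝ ((S l).v x) (rotGen x))
    ((hS.velocity_contDiff.of_le (by norm_num)).inner ℝ (contDiff_rotGen.comp contDiff_snd))
  obtain ⟨pot1, pot2, pot3⟩ := hS.hasDerivAt_integral_density_mul hρ hDo hb
    (q := fun l x => (S l).Φ x) (hS.potential_contDiff.of_le (by norm_num))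
  obtain ⟨int1, int2, int3⟩ := hS.hasDerivAt_integral_internalDensity hρ hDo hb hu
  obtain ⟨fld1, fld3⟩ := hS.hasDerivAt_integral_field hρ hb hG fun x => by
    rw [hS₀]; exact hQ.poisson t₀ x
  simp only [hS.deriv_kinetic] at kin2 kin3
  simp only [hS.deriv_angular] at ang2 ang3
  simp only [hS.deriv_potential] at pot2 pot3
  have kinEq : ∀ l, kineticDensity (S l) = fun x => (S l).ρ x * (1 / 2 * ‖(S l).v x‖ ^ 2) :=
    fun l => funext fun x => by simp only [kineticDensity]; ring
  have gravInt : ∀ l ∈ Icc (-1 : ℝ) 1, Integrable (gravDensity G (S l)) := fun l hl =>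
    (pot1 l hl).add (fld1 l hl)
  have hE : HasDerivAt (fun l => energy G u (S l)) _ 0 :=
    ((kin3.add (pot3.add fld3)).add int3).congr_of_eventuallyEq (by
      filter_upwards [hI] with l hl
      simp only [energy, kinEq, Pi.add_apply]
      congr 2
      exact integral_add (pot1 l hl) (fld1 l hl))
  have hξ := hS.contDiff_displacement
  have hξ1 : ContDiff ℝ 1 fun y => deriv (fun m => Ψ m y) 0 := hξ.of_le (by norm_num)
  set ξ : E3 → E3 := fun y => deriv (fun m => Ψ m y) 0 with hξdef
  have hv : ContDiff ℝ 1 (S 0).v := hS₀ ▸ hQ.contDiff_velocity t₀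
  have hw : ContDiff ℝ 1 (corotVelocity Ω (S 0)) := hS₀ ▸ hQ.contDiff_corotVelocity t₀
  have hP : Continuous ((S 0).P u) := hS₀ ▸ hQ.continuous_pressure hu t₀
  have hF : Continuous (inertialForce Ω (S 0)) := hS₀ ▸ hQ.continuous_inertialForce t₀
  have hΦ : Continuous (S 0).Φ := hS₀ ▸ (hQ.potential_contDiff t₀).continuous
  have hm : Continuous (lagMass S Ψ) := hS.continuous_lagMass hρ
  have hv' := hS.continuous_deriv_velocity_pullback
  have hδ : Continuous fun x => deriv (fun m => (S m).Φ x) 0 :=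
    (contDiff_deriv_slice (m := 1) (F := fun l x => (S l).Φ x) hS.potential_contDiff
      (by norm_num)).continuous.comp (by fun_prop : Continuous fun x : E3 => ((0 : ℝ), x))
  have hrot : Continuous rotGen := (contDiff_rotGen (n := 0)).continuous
  have hcint : ∀ {f : E3 → ℝ}, Continuous f → IntegrableOn f (S 0).region := fun {f} hf => by
    obtain ⟨C, -, hC⟩ := Continuous.exists_bound_of_isBounded hb hf
    exact integrableOn_of_continuousOn_of_bounded hDo hb hf.continuousOn hC
  have hcirc : IntegrableOn (circulationTerm Ω S Ψ) (S 0).region := by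
    refine hcint ?_
    have : circulationTerm Ω S Ψ = fun x => (S 0).ρ x *
        (inner ℝ (deriv (fun m => (S m).v (Ψ m x)) 0) (corotVelocity Ω (S 0) x) +
          inner ℝ ((S 0).v x) (fderiv ℝ ξ x (corotVelocity Ω (S 0) x))) :=
      funext fun x => by rw [circulationTerm, hS.lagVelocity_eq]; rfl
    rw [this]
    exact hρ.mul ((hv'.inner hw.continuous).add (hv.continuous.inner
      ((hξ1.continuous_fderiv (by norm_num)).clm_apply hw.continuous)))
  have hheat := hS.heatTerm_integrableOn hρ hDo hb hu
  have hPdiv : IntegrableOn (fun x => (S 0).P u x * divergence ξ x) (S 0).region :=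
    hcint (hP.mul (continuous_divergence hξ1))
  -- The part with u + P/ρ is recovered from the integrable variation of the internal energy by
  -- removing the heat term and restoring P div ξ; the remaining coefficients are continuous.
  have hmass : IntegrableOn (massTerm Ω u S Ψ) (S 0).region := by
    have h1 : IntegrableOn (fun x => (1 / 2 * ‖(S 0).v x‖ ^ 2 + (S 0).Φ x
        - Ω * inner ℝ ((S 0).v x) (rotGen x)) * lagMass S Ψ x) (S 0).region :=
      hcint ((((continuous_const.mul (hv.continuous.norm.pow 2)).add hΦ).sub
        (continuous_const.mul (hv.continuous.inner hrot))).mul hm)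
    refine (((h1.add int2).sub hheat).add hPdiv).congr_fun (fun x _ => ?_) hDo.measurableSet
    simp only [Pi.add_apply, Pi.sub_apply, massTerm]
    ring
  have heat0 : ∀ x, (S 0).ρ x = 0 → heatTerm u S Ψ x = 0 := fun x hx => by simp [heatTerm, hx]
  have mass0 : ∀ x, (S 0).ρ x = 0 → massTerm Ω u S Ψ x = 0 := fun x hx => by
    simp [massTerm, hS.lagMass_eq_zero hx]
  have circ0 : ∀ x, (S 0).ρ x = 0 → circulationTerm Ω S Ψ x = 0 := fun x hx => by
    simp [circulationTerm, hx]
  have hJd : HasDerivAt (fun l => angularMomentum (S l)) _ 0 := ang3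
  have z1 := hQ.integral_pressure_mul_divergence hu t₀ hξ1
  have z2 := hQ.integral_density_mul_inner t₀ hξ1
  rw [← hS₀] at z1 z2
  have hz1 : IntegrableOn (fun x => (S 0).P u x * divergence ξ x -
      (S 0).ρ x * inner ℝ (inertialForce Ω (S 0) x) (ξ x)) (S 0).region :=
    hPdiv.sub (hcint (hρ.mul (hF.inner hξ1.continuous)))
  have hz2 : IntegrableOn (fun x => (S 0).ρ x *
      (inner ℝ (fderiv ℝ (S 0).v x (corotVelocity Ω (S 0) x)) (ξ x) +
        inner ℝ ((S 0).v x) (fderiv ℝ ξ x (corotVelocity Ω (S 0) x)))) (S 0).region :=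
    hcint (hρ.mul (((((hv.continuous_fderiv (by norm_num)).clm_apply hw.continuous)).inner
      hξ1.continuous).add (hv.continuous.inner
        ((hξ1.continuous_fderiv (by norm_num)).clm_apply hw.continuous))))
  have hδint : IntegrableOn (fun x => (S 0).ρ x * deriv (fun m => (S m).Φ x) 0) (S 0).region :=
    hcint (hρ.mul hδ)
  have hfirst : HasDerivAt (fun l => energy G u (S l))
      (Ω * deriv (fun l => angularMomentum (S l)) 0 + (∫ x, heatTerm u S Ψ x)
        + (∫ x, massTerm Ω u S Ψ x) + ∫ x, circulationTerm Ω S Ψ x) 0 := by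
    refine hE.congr_deriv ?_
    rw [hJd.deriv, ← setIntegral_region_eq hρ0 heat0, ← setIntegral_region_eq hρ0 mass0,
      ← setIntegral_region_eq hρ0 circ0,
      ← setIntegral_region_eq (f := fun x => (S 0).ρ x * deriv (fun m => (S m).Φ x) 0) hρ0
        (fun x hx => by rw [hx, zero_mul])]
    refine integral_balance kin2 pot2 hδint int2 ang2 hheat hmass hcirc hz1 hz2 z1 z2 ?_
    refine (ae_restrict_iff' hDo.measurableSet).2 (ae_of_all _ fun x hx => ?_)
    -- Pointwise identity: the heat terms and those with Δ(ρ dV) match, v̇ enters on both sides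
    -- through v = w + Ωφ, and skewness collects what multiplies ξ into F - ∇_w v.
    have hskew := inner_rotGen ((S 0).v x) (ξ x)
    simp only [massTerm, circulationTerm, hS.lagVelocity_eq, inertialForce, inner_add_left,
      real_inner_smul_left, hskew, ← hξdef, show deriv (fun m => Ψ m x) 0 = ξ x from rfl,
      show (S 0).v x - Ω • rotGen x = corotVelocity Ω (S 0) x from rfl]
    have hcor : (inner ℝ (deriv (fun m => (S m).v (Ψ m x)) 0) (corotVelocity Ω (S 0) x) : ℝ) =
        inner ℝ ((S 0).v x) (deriv (fun m => (S m).v (Ψ m x)) 0) -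
          Ω * inner ℝ (deriv (fun m => (S m).v (Ψ m x)) 0) (rotGen x) := by
      rw [corotVelocity, inner_sub_right, real_inner_smul_right, real_inner_comm]
    rw [hcor]
    ring
  refine ⟨?_, integrable_of_integrableOn_region hρ0 heat0 hheat,
    integrable_of_integrableOn_region hρ0 mass0 hmass,
    integrable_of_integrableOn_region hρ0 circ0 hcirc, hJd.differentiableAt, hfirst, ?_⟩
  · filter_upwards [hI] with l hl
    exact ⟨by rw [kinEq]; exact kin1 l hl, gravInt l hl, int1 l hl, ang1 l hl⟩
  · intro hsc hs hM hω
    refine hfirst.congr_deriv ?_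
    rw [← setIntegral_region_eq hρ0 heat0, ← setIntegral_region_eq hρ0 mass0,
      ← setIntegral_region_eq hρ0 circ0, hS.integral_circulationTerm_eq_zero hQ hS₀ hsc hω,
      setIntegral_eq_zero_of_forall_eq_zero fun x hx => by rw [heatTerm, hs x hx, mul_zero],
      setIntegral_eq_zero_of_forall_eq_zero fun x hx => by rw [massTerm, hM x hx, mul_zero]]
    ring
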